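/- Let $K$ be a field of characteristic zero and $R=K[\mathbb P^3]=K[x_0,\dots,x_3]$ with the standard grading. For a point $p\in\mathbb P^3$ let $\mathfrak m_p\subset R$ be the ideal generated by the forms vanishing at $p$, and for points $p_1,\dots,p_n\in\mathbb P^3$ and integers $m_1,\dots,m_n\ge 1$ let $I_p(m_1,\dots,m_n)=\bigcap_{j=1}^n \mathfrak m_{p_j}^{m_j}$. For a homogeneous ideal $I\subset R$ let $I^{(m)}=R\cap\bigcap_{\mathfrak p\in\mathrm{Ass}(I)}I^mR_{\mathfrak p}$ be its $m$-th symbolic power, let $\alpha(I)$ be the least degree of a nonzero form in $I$, and let $\gamma(I)=\lim_{m\to\infty}\alpha(I^{(m)})/m$ be its Waldschmidt constant. Write $I(m_1,\dots,m_n)$ for the ideal of $n$ generic fat points with these multiplicities: $\alpha(I(m_1,\dots,m_n)^{(m)})$ is the common value of $\alpha(I_p(m_1,\dots,m_n)^{(m)})$ for all $p=(p_1,\dots,p_n)$ in a suitable nonempty Zariski open subset $U_m$ of $(\mathbb P^3)^n$ (which may depend on $m$), and $\gamma(I(m_1,\dots,m_n))=\lim_{m\to\infty}\alpha(I(m_1,\dots,m_n)^{(m)})/m$.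 Thus $\gamma(I_p(m_1,\dots,m_n))=\gamma(I(m_1,\dots,m_n))$ for every $p\in\bigcap_m U_m$. Let $1^{\times n}$ denote the sequence $(1,\dots,1)$ of length $n$. Then these generic values and limits exist for the multiplicities below, and the following inequalities hold: 1. $\gamma(I(1))\ge 1$; 2. $\gamma(I(1^{\times 4}))\ge \frac43$; 3. $\gamma(I(1^{\times n}))\ge \frac53$ for $n=5,6,7$; 4. $\gamma(I(1^{\times 24}))\ge \frac{23}{9}$; 5. $\gamma(I(2,2,2,1,1))\ge \frac83$; 6. $\gamma(I(2,2,1,1,1))\ge \frac73$. -/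

import Mathlib

open Filter Topology

noncomputable section

namespace FatPoints

/-- The projective space `ℙ^N` of `K`-points, with homogeneous coordinates `x_0, …, x_N`. -/
abbrev PP (K : Type*) [Field K] (N : ℕ) : Type _ := Projectivization K (Fin (N + 1) → K)

/-- The homogeneous coordinate ring `K[ℙ^N] = K[x_0, …, x_N]`. -/
abbrev CoordRing (K : Type*) [Field K] (N : ℕ) : Type _ := MvPolynomial (Fin (N + 1)) K

/-- The ideal `𝔪_p` generated by the forms that vanish at `p`. The vanishing of a form does not
depend on the chosen homogeneous coordinates of `p`. -/
def pointIdeal {K : Type*} [Field K] {N : ℕ} (p : PP K N) : Ideal (CoordRing K N) :=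
  Ideal.span {f | (∃ d : ℕ, f.IsHomogeneous d) ∧ MvPolynomial.eval p.rep f = 0}

/-- The fat points ideal `⋂ j, 𝔪_{p_j} ^ (μ_j)`. -/
def fatPointsIdeal {K : Type*} [Field K] {N n : ℕ} (p : Fin n → PP K N) (μ : Fin n → ℕ) :
    Ideal (CoordRing K N) :=
  ⨅ j, pointIdeal (p j) ^ μ j

/-- The contraction to `R` of the extension of `J` to the localization `R_P`. -/
def localContraction {R : Type*} [CommRing R] (J P : Ideal R) (hP : P.IsPrime) : Ideal R :=
  (J.map (algebraMap R (Localization.AtPrime P))).comap (algebraMap R (Localization.AtPrime P))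

/-- The symbolic power `I^(m) = R ∩ ⋂_{P ∈ Ass(I)} I^m R_P`, where `Ass(I)` is the set of
associated primes of the module `R ⧸ I`. -/
def symbolicPower {R : Type*} [CommRing R] (I : Ideal R) (m : ℕ) : Ideal R :=
  ⨅ P : associatedPrimes R (R ⧸ I), localContraction (I ^ m) P.1 P.2.isPrime

/-- `α(I)`: the least degree of a nonzero form in `I`. -/
def alpha {K : Type*} [Field K] {N : ℕ} (I : Ideal (CoordRing K N)) : ℕ :=
  sInf {t : ℕ | ∃ f ∈ I, f ≠ 0 ∧ f.IsHomogeneous t}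

/-- `g` is the Waldschmidt constant `γ(I) = lim α(I^(m)) / m`; the limit is required to exist. -/
def HasWaldschmidtConstant {K : Type*} [Field K] {N : ℕ} (I : Ideal (CoordRing K N)) (g : ℝ) :
    Prop :=
  Tendsto (fun m : ℕ => (alpha (symbolicPower I m) : ℝ) / (m : ℝ)) atTop (𝓝 g)

/-- `f`, a polynomial in `n` groups of `N + 1` variables, is homogeneous of degree `d j` in the
`j`-th group for every `j`. -/
def IsMultihomogeneous {K : Type*} [Field K] {N n : ℕ}
    (f : MvPolynomial (Fin n × Fin (N + 1)) K) (d : Fin n → ℕ) : Prop :=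
  ∀ c ∈ f.support, ∀ j, ∑ i, c (j, i) = d j

/-- The Zariski closed subsets of `(ℙ^N)^n`: the common zero sets of families of multihomogeneous
polynomials. -/
def IsZariskiClosed {K : Type*} [Field K] {N n : ℕ} (Z : Set (Fin n → PP K N)) : Prop :=
  ∃ S : Set (MvPolynomial (Fin n × Fin (N + 1)) K),
    (∀ f ∈ S, ∃ d, IsMultihomogeneous f d) ∧
    Z = {p | ∀ f ∈ S, MvPolynomial.eval (fun ji => (p ji.1).rep ji.2) f = 0}

def IsZariskiOpen {K : Type*} [Field K] {N n : ℕ} (U : Set (Fin n → PP K N)) : Prop :=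
  IsZariskiClosed Uᶜ

/-- `g` is the Waldschmidt constant `γ(I(μ))` of the ideal `I(μ)` of generic fat points in `ℙ^N`
with multiplicities `μ = (μ_1, …, μ_n)`.

For each `m`, the number `α(I(μ)^(m))` is the common value `a m` of `α(I^(m))` on the ideals `I`
of `n` fat points that range over a nonempty Zariski open subset `U m` of `(ℙ^N)^n` (two such sets
meet when `K` is infinite, so `a m` does not depend on `U m`), and `g` is the limit of `a m / m`.
Hence `g` is also the Waldschmidt constant of the ideal of every single system of points that lies
in all the sets `U m`. -/
def IsGenericWaldschmidtConstant (K : Type*) [Field K] (N : ℕ) {n : ℕ} (μ : Fin n → ℕ) (g : ℝ) :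
    Prop :=
  ∃ (U : ℕ → Set (Fin n → PP K N)) (a : ℕ → ℕ),
    (∀ m, IsZariskiOpen (U m) ∧ (U m).Nonempty) ∧
    (∀ m, ∀ p ∈ U m, alpha (symbolicPower (fatPointsIdeal p μ) m) = a m) ∧
    Tendsto (fun m : ℕ => (a m : ℝ) / (m : ℝ)) atTop (𝓝 g) ∧
    ∀ p ∈ ⋂ m, U m, HasWaldschmidtConstant (fatPointsIdeal p μ) g

end FatPoints

end

/-! The generic value of α for the m-th symbolic power is the least degree in which every system of
vectors carries a nonzero form with the required vanishing. Carrying such a form means that all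
maximal minors of a linear system vanish (`hasForm_iff`). The minors are multihomogeneous in the
points, so one system without a form gives a nonempty Zariski open set of such systems. For distinct
points, symbolic powers just multiply the multiplicities (`symbolicPower_fatPointsIdeal`). Hence the
least degrees are subadditive in m, and Fekete's lemma gives the limit
(`exists_isGenericWaldschmidtConstant`). A lower bound then needs only one convenient special
position, over K or over a larger domain (`hasForm_of_forall_hasForm`).

For one point, restrict to a line. For the other cases except 24 points, take the twisted cubic
through the four coordinate points, the unit point and a sixth point where the form is nonzero.
Bézout on this curve gives ∑ m_j ≤ 3t (`sum_le_three_mul_of_dvd_homothety`).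

For 24 points, let w_0, …, w_4 be the base points and place points w_i + ε(w_j − w_i) over K[ε],
leaving out one of the 25 pairs. Let f be the limit of a form at ε = 0 and d_i its order at w_i.
Magnifying around w_i by 1/ε and letting ε → 0 yields, after removal of a power of the hyperplane at
infinity, a form of degree at most d_i with order at least m at the base points of that cluster. The
cubic bounds the sum of these multiplicities by 3d_i (`sum_le_three_mul_of_collision`). With ∑ d_i ≤
3t this gives 24m ≤ 9t. -/

noncomputable section

namespace FatPoints

open MvPolynomial

/-! ### Linear systems and maximal minors. -/

section LinearAlgebra

/-- If the rows span, a basis chosen among them is a square block with nonzero determinant.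
Otherwise a nonzero functional killing their span supplies the solution. -/
theorem exists_ne_zero_forall_sum_eq_zero_of_field {ι κ L : Type*} [Field L] [Fintype κ]
    [DecidableEq κ] (M : ι → κ → L) (h : ∀ r : κ → ι, (Matrix.of fun a b => M (r a) b).det = 0) :
    ∃ x : κ → L, x ≠ 0 ∧ ∀ i, ∑ b, M i b * x b = 0 := by
  by_cases hs : Submodule.span L (Set.range M) = ⊤
  · exfalso
    obtain ⟨s, hs₁, hs₂, hs₃⟩ := exists_linearIndependent L (Set.range M)
    rw [hs] at hs₂
    let B : Module.Basis s L (κ → L) := Module.Basis.mk hs₃ (by simp [hs₂])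
    let e : s ≃ κ := B.indexEquiv (Pi.basisFun L κ)
    choose r hr using fun a : κ => hs₁ (e.symm a).2
    have hli : LinearIndependent L (fun a => M (r a)) := by
      have : (fun a => M (r a)) = (fun x : s => (x : κ → L)) ∘ e.symm := funext hr
      rw [this]
      exact hs₃.comp _ e.symm.injective
    have hu : IsUnit (Matrix.of fun a b => M (r a) b) :=
      Matrix.linearIndependent_rows_iff_isUnit.mp hli
    rw [Matrix.isUnit_iff_isUnit_det, h r] at hu
    exact not_isUnit_zero hu
  · obtain ⟨f, hf, hle⟩ := Submodule.exists_le_ker_of_lt_top _ (lt_top_iff_ne_top.mpr hs)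
    refine ⟨fun b => f (Pi.single b 1), fun h0 => hf ?_, fun i => ?_⟩
    · refine LinearMap.pi_ext' fun b => LinearMap.ext_ring ?_
      simpa using congrFun h0 b
    · have := hle (Submodule.subset_span ⟨i, rfl⟩)
      rw [LinearMap.mem_ker, ← Finset.univ_sum_single (M i), map_sum] at this
      rw [← this]
      refine Finset.sum_congr rfl fun b _ => ?_
      rw [← smul_eq_mul, ← map_smul, ← Pi.single_smul, smul_eq_mul, mul_one]

/-- A homogeneous linear system over a domain, with possibly infinitely many equations in finitely
many unknowns, has a nonzero solution if and only if its maximal minors vanish. -/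
theorem exists_ne_zero_forall_sum_eq_zero_iff {ι κ A : Type*} [CommRing A] [IsDomain A] [Fintype κ]
    [DecidableEq κ] (M : ι → κ → A) :
    (∃ x : κ → A, x ≠ 0 ∧ ∀ i, ∑ b, M i b * x b = 0) ↔
      ∀ r : κ → ι, (Matrix.of fun a b => M (r a) b).det = 0 := by
  constructor
  · rintro ⟨x, hx, h⟩ r
    exact Matrix.exists_mulVec_eq_zero_iff.mp ⟨x, hx, funext fun a => h (r a)⟩
  · intro h
    let L := FractionRing A
    have hinj : Function.Injective (algebraMap A L) := IsFractionRing.injective A L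
    obtain ⟨x, hx, hM⟩ := exists_ne_zero_forall_sum_eq_zero_of_field
      (fun i b => algebraMap A L (M i b)) fun r => by
        have := congrArg (algebraMap A L) (h r)
        rwa [RingHom.map_det, map_zero] at this
    obtain ⟨c, hc⟩ := IsLocalization.exist_integer_multiples_of_finite (nonZeroDivisors A) x
    choose y hy using hc
    have hc0 : algebraMap A L c ≠ 0 := fun h0 =>
      nonZeroDivisors.coe_ne_zero c (hinj (h0.trans (map_zero _).symm))
    refine ⟨y, fun h0 => hx (funext fun b => ?_), fun i => hinj ?_⟩
    · have := hy b
      rw [h0, Pi.zero_apply, map_zero, Algebra.smul_def] at this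
      exact (mul_eq_zero.mp this.symm).resolve_left hc0
    · rw [map_sum, map_zero]
      calc ∑ b, algebraMap A L (M i b * y b)
          = algebraMap A L c * ∑ b, algebraMap A L (M i b) * x b := by
            rw [Finset.mul_sum]
            refine Finset.sum_congr rfl fun b _ => ?_
            rw [map_mul, hy, Algebra.smul_def]; ring
        _ = 0 := by rw [hM, mul_zero]

end LinearAlgebra

theorem aeval_mul_left_of_isHomogeneous {σ A B : Type*} [CommRing A] [CommRing B] [Algebra A B]
    {f : MvPolynomial σ A} {t : ℕ} (hf : f.IsHomogeneous t) (r : B) (g : σ → B) :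
    aeval (fun i => r * g i) f = r ^ t * aeval g f := by
  rw [aeval_def, aeval_def, eval₂_eq, eval₂_eq, Finset.mul_sum]
  refine Finset.sum_congr rfl fun d hd => ?_
  have : ∑ i ∈ d.support, d i = t := (hf.degree_eq_sum_deg_support hd).symm
  simp_rw [mul_pow, Finset.prod_mul_distrib, Finset.prod_pow_eq_pow_sum, this]
  ring

/-! ### Taylor expansion at a vector. -/

section Transl

variable {σ A : Type*} [CommRing A]

/-- Expansion along the lines through the vector `v`. -/
def transl (v : σ → A) : MvPolynomial σ A →ₐ[A] Polynomial (MvPolynomial σ A) :=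
  aeval fun i => Polynomial.C (C (v i)) + Polynomial.X * Polynomial.C (X i)

theorem transl_X (v : σ → A) (i : σ) :
    transl v (X i) = Polynomial.C (C (v i)) + Polynomial.X * Polynomial.C (X i) :=
  aeval_X _ _

theorem transl_C (v : σ → A) (a : A) : transl v (C a) = Polynomial.C (C a) := by
  rw [transl, algHom_C]; rfl

end Transl

/-! ### Homotheties about a vector, and order of vanishing. -/

section Homothety

variable {σ A : Type*} [CommRing A] [Fintype σ]

def linForm (l : σ → A) : MvPolynomial σ A := ∑ i, C (l i) * X i

/-- The coordinates of the projection from the point `v` to the hyperplane `l = 0`. -/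
def projCoord (l v : σ → A) (i : σ) : MvPolynomial σ A := X i - C (v i) * linForm l

/-- Expansion along the one-parameter family of homotheties `s` which fix the vector `v` and
scale the hyperplane `l = 0` by `s`. -/
def homothety (l v : σ → A) : MvPolynomial σ A →ₐ[A] Polynomial (MvPolynomial σ A) :=
  aeval fun i =>
    Polynomial.C (C (v i) * linForm l) + Polynomial.X * Polynomial.C (projCoord l v i)

theorem homothety_X (l v : σ → A) (i : σ) : homothety l v (X i) =
    Polynomial.C (C (v i) * linForm l) + Polynomial.X * Polynomial.C (projCoord l v i) :=
  aeval_X _ _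

theorem homothety_C (l v : σ → A) (a : A) : homothety l v (C a) = Polynomial.C (C a) := by
  rw [homothety, algHom_C]; rfl

variable {l v : σ → A}

theorem eval_linForm (l v : σ → A) : eval v (linForm l) = ∑ i, l i * v i := by
  simp [linForm]

theorem sum_mul_projCoord (h : ∑ i, l i * v i = 1) : ∑ i, C (l i) * projCoord l v i = 0 := by
  have : ∑ i, C (l i) * (C (v i) * linForm l) = linForm l := by
    simp_rw [← mul_assoc, ← Finset.sum_mul, ← map_mul, ← map_sum, h, map_one, one_mul]
  simp_rw [projCoord, mul_sub, Finset.sum_sub_distrib, this]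
  exact sub_self _

theorem homothety_linForm (h : ∑ i, l i * v i = 1) :
    homothety l v (linForm l) = Polynomial.C (linForm l) := by
  have h1 : ∑ i, C (l i) * (C (v i) * linForm l) = linForm l := by
    simp_rw [← mul_assoc, ← Finset.sum_mul, ← map_mul, ← map_sum, h, map_one, one_mul]
  conv_lhs => rw [linForm]
  simp_rw [map_sum, map_mul, homothety_X, homothety_C, mul_add, Finset.sum_add_distrib,
    ← Polynomial.C_mul]
  rw [← map_sum, h1]
  simp_rw [mul_left_comm _ Polynomial.X, ← Finset.mul_sum, ← Polynomial.C_mul]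
  rw [← map_sum, sum_mul_projCoord h]
  simp

theorem homothety_projCoord (h : ∑ i, l i * v i = 1) (i : σ) :
    homothety l v (projCoord l v i) = Polynomial.X * Polynomial.C (projCoord l v i) := by
  conv_lhs => rw [projCoord]
  rw [map_sub, map_mul, homothety_X, homothety_C, homothety_linForm h, Polynomial.C_mul]
  ring

theorem eval_one_homothety (l v : σ → A) (f : MvPolynomial σ A) :
    (homothety l v f).eval 1 = f := by
  induction f using MvPolynomial.induction_on with
  | C a => simp
  | add p q hp hq => rw [map_add, Polynomial.eval_add, hp, hq]
  | mul_X p i hp =>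
    rw [map_mul, Polynomial.eval_mul, hp, homothety_X]
    simp [projCoord]

theorem homothety_ne_zero {f : MvPolynomial σ A} (hf : f ≠ 0) : homothety l v f ≠ 0 := fun h =>
  hf (by rw [← eval_one_homothety l v f, h, Polynomial.eval_zero])

/-- Homotheties about the same vector compose by multiplying their ratios. -/
theorem homothety_eval (h : ∑ i, l i * v i = 1) (f : MvPolynomial σ A) (a : A) :
    homothety l v ((homothety l v f).eval (C a)) =
      (homothety l v f).comp (Polynomial.C (C a) * Polynomial.X) := by
  induction f using MvPolynomial.induction_on with
  | C b => simp
  | add p q hp hq => rw [map_add, Polynomial.eval_add, map_add, hp, hq, Polynomial.add_comp]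
  | mul_X p i hp =>
    rw [map_mul, Polynomial.eval_mul, map_mul, hp, Polynomial.mul_comp, homothety_X]
    simp only [Polynomial.eval_add, Polynomial.eval_mul, Polynomial.eval_C, Polynomial.eval_X,
      map_add, map_mul, homothety_C, homothety_linForm h, homothety_projCoord h,
      Polynomial.add_comp, Polynomial.mul_comp, Polynomial.C_comp, Polynomial.X_comp]
    ring

theorem homothety_mem_reesAlgebra (l v : σ → A) (f : MvPolynomial σ A) :
    homothety l v f ∈ reesAlgebra (Ideal.span (Set.range (projCoord l v))) := by
  induction f using MvPolynomial.induction_on with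
  | C a => rw [homothety_C]; exact Subalgebra.algebraMap_mem _ _
  | add p q hp hq => rw [map_add]; exact add_mem hp hq
  | mul_X p i hp =>
    rw [map_mul, homothety_X]
    refine mul_mem hp <| add_mem (Subalgebra.algebraMap_mem _ _) ?_
    rw [mul_comm, ← pow_one Polynomial.X, Polynomial.C_mul_X_pow_eq_monomial]
    exact reesAlgebra.monomial_mem.mpr (by rw [pow_one]; exact Ideal.subset_span ⟨i, rfl⟩)

/-- The homothety multiplies each generator by the parameter, which gives one direction. Conversely,
`f` is the value of its expansion at 1, and membership in the Rees algebra puts the k-th coefficient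
in the k-th power of the ideal. -/
theorem mem_span_projCoord_pow_iff (h : ∑ i, l i * v i = 1) {f : MvPolynomial σ A} {m : ℕ} :
    f ∈ Ideal.span (Set.range (projCoord l v)) ^ m ↔ Polynomial.X ^ m ∣ homothety l v f := by
  constructor
  · intro hf
    have hle : Ideal.span (Set.range (projCoord l v)) ≤
        (Ideal.span {Polynomial.X}).comap (homothety l v) := by
      rw [Ideal.span_le]
      rintro _ ⟨i, rfl⟩
      exact Ideal.mem_span_singleton.mpr ⟨_, homothety_projCoord h i⟩
    have := (Ideal.pow_right_mono hle m).trans (Ideal.le_comap_pow _ m) hf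
    rwa [Ideal.mem_comap, Ideal.span_singleton_pow, Ideal.mem_span_singleton] at this
  · intro hf
    rw [← eval_one_homothety l v f, Polynomial.eval_eq_sum_range]
    refine Ideal.sum_mem _ fun k _ => ?_
    rw [one_pow, mul_one]
    rcases lt_or_ge k m with hk | hk
    · rw [Polynomial.X_pow_dvd_iff.mp hf k hk]
      exact zero_mem _
    · exact Ideal.pow_le_pow_right hk (homothety_mem_reesAlgebra l v f k)

/-- Coefficientwise divisibility of the expansion of a form by powers of the hyperplane. -/
theorem linForm_pow_dvd_coeff_homothety {f : MvPolynomial σ A} {t : ℕ} (hf : f.IsHomogeneous t)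
    (k : ℕ) : linForm l ^ (t - k) ∣ (homothety l v f).coeff k := by
  -- The estimate is multiplicative, so it only has to be checked on the variables.
  have hmul : ∀ (t₁ t₂ : ℕ) (P Q : Polynomial (MvPolynomial σ A)),
      (∀ k, linForm l ^ (t₁ - k) ∣ P.coeff k) → (∀ k, linForm l ^ (t₂ - k) ∣ Q.coeff k) →
      ∀ k, linForm l ^ (t₁ + t₂ - k) ∣ (P * Q).coeff k := by
    intro t₁ t₂ P Q hP hQ k
    rw [Polynomial.coeff_mul]
    refine Finset.dvd_sum fun x hx => ?_
    have hx := Finset.HasAntidiagonal.mem_antidiagonal.mp hx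
    refine (pow_dvd_pow _ (by omega : t₁ + t₂ - k ≤ (t₁ - x.1) + (t₂ - x.2))).trans ?_
    rw [pow_add]
    exact mul_dvd_mul (hP _) (hQ _)
  have hX : ∀ i k, linForm l ^ (1 - k) ∣ (homothety l v (X i)).coeff k := by
    intro i k
    rcases k with _ | k
    · rw [homothety_X]; simp
    · simp
  have hpow : ∀ i n k, linForm l ^ (n - k) ∣ (homothety l v (X i) ^ n).coeff k := by
    intro i n
    induction n with
    | zero => simp
    | succ n ih => rw [pow_succ]; exact hmul _ _ _ _ ih (hX i)
  have hprod : ∀ (d : σ →₀ ℕ) (s : Finset σ) (k : ℕ),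
      linForm l ^ ((∑ i ∈ s, d i) - k) ∣ (∏ i ∈ s, homothety l v (X i) ^ d i).coeff k := by
    classical
    intro d s
    induction s using Finset.induction_on with
    | empty => simp
    | insert a s ha ih =>
      rw [Finset.sum_insert ha, Finset.prod_insert ha]
      exact hmul _ _ _ _ (hpow a _) ih
  rw [f.as_sum, map_sum, Polynomial.finsetSum_coeff]
  refine Finset.dvd_sum fun d hd => ?_
  rw [monomial_eq, map_mul, homothety_C, Polynomial.coeff_C_mul, Finsupp.prod, map_prod]
  simp_rw [map_pow]
  have := hprod d d.support k
  rw [← hf.degree_eq_sum_deg_support hd] at this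
  exact this.mul_left _

theorem X_pow_dvd_transl_of_homothety (h : ∑ i, l i * v i = 1) {f : MvPolynomial σ A} {m : ℕ}
    (hf : Polynomial.X ^ m ∣ homothety l v f) : Polynomial.X ^ m ∣ transl v f := by
  have hL : transl v (linForm l) = 1 + Polynomial.X * Polynomial.C (linForm l) := by
    simp_rw [linForm, map_sum, map_mul, transl_X, transl_C, mul_add, Finset.sum_add_distrib,
      mul_left_comm _ Polynomial.X, ← Finset.mul_sum, ← Polynomial.C_mul, ← C_mul]
    rw [← map_sum, ← map_sum, h]
    simp
  have hle : Ideal.span (Set.range (projCoord l v)) ≤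
      (Ideal.span {Polynomial.X}).comap (transl v) := by
    rw [Ideal.span_le]
    rintro _ ⟨i, rfl⟩
    refine Ideal.mem_span_singleton.mpr
      ⟨Polynomial.C (X i) - Polynomial.C (C (v i)) * Polynomial.C (linForm l), ?_⟩
    change transl v (projCoord l v i) = _
    rw [projCoord, map_sub, map_mul, transl_X, transl_C, hL]
    ring
  have := (Ideal.pow_right_mono hle m).trans (Ideal.le_comap_pow _ m)
    ((mem_span_projCoord_pow_iff h).mpr hf)
  rwa [Ideal.mem_comap, Ideal.span_singleton_pow, Ideal.mem_span_singleton] at this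

theorem linForm_ne_zero [Nontrivial A] (h : ∑ i, l i * v i = 1) : linForm l ≠ 0 := fun h0 => by
  rw [← eval_linForm, h0, map_zero] at h
  exact zero_ne_one h

/-- With L the linear form and y the projected coordinates, homogeneity gives f(L(v + sy)) = L^t f(v
+ sy). Comparing coefficients of s and cancelling powers of L transfers the divisibility. The
conditions from `transl` are polynomial in `v` and require no choice of `l`. -/
theorem X_pow_dvd_homothety_of_transl [IsDomain A] (h : ∑ i, l i * v i = 1)
    {f : MvPolynomial σ A} {t m : ℕ} (ht : f.IsHomogeneous t) (hf : Polynomial.X ^ m ∣ transl v f) :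
    Polynomial.X ^ m ∣ homothety l v f := by
  have h1 : ∀ g : MvPolynomial σ A,
      (homothety l v g).comp (Polynomial.C (linForm l) * Polynomial.X) =
      aeval (fun i => Polynomial.C (linForm l) *
        (Polynomial.C (C (v i)) + Polynomial.X * Polynomial.C (projCoord l v i))) g := by
    intro g
    induction g using MvPolynomial.induction_on with
    | C a => simp
    | add p q hp hq => rw [map_add, map_add, Polynomial.add_comp, hp, hq]
    | mul_X p i hp =>
      rw [map_mul, map_mul, Polynomial.mul_comp, hp, homothety_X, aeval_X]
      simp only [map_mul, Polynomial.add_comp, Polynomial.mul_comp, Polynomial.C_comp,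
        Polynomial.X_comp]
      ring
  have h2 : ∀ g : MvPolynomial σ A,
      (transl v g).map (aeval (projCoord l v) : MvPolynomial σ A →ₐ[A] _).toRingHom =
      aeval (fun i => Polynomial.C (C (v i)) + Polynomial.X * Polynomial.C (projCoord l v i))
        g := by
    intro g
    induction g using MvPolynomial.induction_on with
    | C a => simp
    | add p q hp hq => rw [map_add, map_add, Polynomial.map_add, hp, hq]
    | mul_X p i hp =>
      rw [map_mul, map_mul, Polynomial.map_mul, hp, transl_X, aeval_X]
      simp
  have key := h1 f
  rw [aeval_mul_left_of_isHomogeneous ht, ← h2] at key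
  rw [Polynomial.X_pow_dvd_iff] at hf ⊢
  intro k hk
  have := congrArg (fun P => Polynomial.coeff P k) key
  simp only [Polynomial.comp_C_mul_X_coeff, ← Polynomial.C_pow, Polynomial.coeff_C_mul,
    Polynomial.coeff_map, hf k hk, map_zero, mul_zero] at this
  exact (mul_eq_zero.mp this).resolve_right (pow_ne_zero _ (linForm_ne_zero h))

end Homothety

/-! ### Vanishing conditions as minors, multihomogeneous in the points. -/

section Minors

theorem transl_map {σ A B : Type*} [CommRing A] [CommRing B] (φ : A →+* B) (v : σ → A)
    (f : MvPolynomial σ A) :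
    transl (fun i => φ (v i)) (map φ f) = (transl v f).map (map φ) := by
  induction f using MvPolynomial.induction_on with
  | C a => simp
  | add p q hp hq => rw [map_add, map_add, map_add, Polynomial.map_add, hp, hq]
  | mul_X p i hp =>
    rw [map_mul, map_mul, map_mul, Polynomial.map_mul, hp, map_X, transl_X, transl_X]
    simp

/-- There is a nonzero form of degree `t` that vanishes at each vector `v j` to order `M j`. -/
def HasForm {σ A : Type*} [CommRing A] {n : ℕ} (v : Fin n → σ → A) (M : Fin n → ℕ) (t : ℕ) :
    Prop :=
  ∃ F : MvPolynomial σ A, F ≠ 0 ∧ F.IsHomogeneous t ∧ ∀ j, Polynomial.X ^ M j ∣ transl (v j) F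

variable {σ : Type*} {n : ℕ}

abbrev MonomialIndex (σ : Type*) [Fintype σ] [DecidableEq σ] (t : ℕ) : Type _ :=
  {b : σ →₀ ℕ // b ∈ (Finset.univ : Finset σ).finsuppAntidiag t}

/-- The index set of the linear conditions imposed on a form by vanishing at `n` points. -/
abbrev ConditionIndex (σ : Type*) (M : Fin n → ℕ) : Type _ :=
  {r : Fin n × ℕ × (σ →₀ ℕ) // r.2.1 < M r.1}

def conditionEntry {A : Type*} [CommRing A] (v : Fin n → σ → A) (r : Fin n × ℕ × (σ →₀ ℕ))
    (b : σ →₀ ℕ) : A :=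
  ((transl (v r.1) (monomial b 1)).coeff r.2.1).coeff r.2.2

theorem map_conditionEntry {A B : Type*} [CommRing A] [CommRing B] (φ : A →+* B)
    (v : Fin n → σ → A) (r : Fin n × ℕ × (σ →₀ ℕ)) (b : σ →₀ ℕ) :
    φ (conditionEntry v r b) = conditionEntry (fun j i => φ (v j i)) r b := by
  have := transl_map φ (v r.1) (monomial b 1)
  rw [map_monomial, map_one] at this
  rw [conditionEntry, conditionEntry, this, Polynomial.coeff_map, coeff_map]

/-- The weights whose weighted homogeneous polynomials are the multihomogeneous ones. -/
def groupWeight (n : ℕ) (σ : Type*) (ji : Fin n × σ) : Fin n → ℕ := Pi.single ji.1 1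

theorem isMultihomogeneous_of_isWeightedHomogeneous {K : Type*} [Field K] {N : ℕ}
    {f : MvPolynomial (Fin n × Fin (N + 1)) K} {d : Fin n → ℕ}
    (hf : IsWeightedHomogeneous (groupWeight n (Fin (N + 1))) f d) : IsMultihomogeneous f d := by
  intro c hc j
  rw [← hf (mem_support_iff.mp hc), Finsupp.weight_apply, Finsupp.sum_fintype _ _ (by simp),
    Finset.sum_apply, Fintype.sum_prod_type]
  simp [groupWeight, Pi.single_apply]

/-- Each variable of the monomial becomes either a coordinate of the j-th vector or the parameter
times a variable. Counting the parameter like one such coordinate, every factor has weight 1, and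
weights add under products. -/
theorem weight_add_of_coeff_transl_monomial_ne_zero {K : Type*} [Field K] [DecidableEq σ] (j : Fin n)
    (b : σ →₀ ℕ) (k : ℕ) (a : σ →₀ ℕ) (c : Fin n × σ →₀ ℕ)
    (h : coeff c (coeff a ((transl (fun i => (X (j, i) : MvPolynomial (Fin n × σ) K))
      (monomial b 1)).coeff k)) ≠ 0) :
    Finsupp.weight (groupWeight n σ) c + k • Pi.single j 1 = b.degree • Pi.single j 1 := by
  let Q : ℕ → Polynomial (MvPolynomial σ (MvPolynomial (Fin n × σ) K)) → Prop := fun t P =>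
    ∀ k a c, coeff c (coeff a (P.coeff k)) ≠ 0 →
      Finsupp.weight (groupWeight n σ) c + k • Pi.single j 1 = t • Pi.single j 1
  have hmul : ∀ t₁ t₂ P₁ P₂, Q t₁ P₁ → Q t₂ P₂ → Q (t₁ + t₂) (P₁ * P₂) := by
    intro t₁ t₂ P₁ P₂ h₁ h₂ k a c h
    rw [Polynomial.coeff_mul, coeff_sum, coeff_sum] at h
    obtain ⟨x, hx, h⟩ := Finset.exists_ne_zero_of_sum_ne_zero h
    rw [coeff_mul, coeff_sum] at h
    obtain ⟨y, hy, h⟩ := Finset.exists_ne_zero_of_sum_ne_zero h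
    rw [coeff_mul] at h
    obtain ⟨z, hz, h⟩ := Finset.exists_ne_zero_of_sum_ne_zero h
    have e₁ := h₁ _ _ _ (left_ne_zero_of_mul h)
    have e₂ := h₂ _ _ _ (right_ne_zero_of_mul h)
    rw [← Finset.HasAntidiagonal.mem_antidiagonal.mp hx,
      ← Finset.HasAntidiagonal.mem_antidiagonal.mp hz, map_add, add_smul, add_smul, ← e₁, ← e₂]
    abel
  have hone : Q 0 1 := by
    intro k a c h
    rw [Polynomial.coeff_one] at h
    split_ifs at h with hk
    · rw [coeff_one] at h
      split_ifs at h with ha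
      · rw [coeff_one] at h
        split_ifs at h with hc
        · subst hc; subst hk; simp
        · exact absurd rfl h
      · simp at h
    · simp at h
  have hX : ∀ i, Q 1 (transl (fun i => (X (j, i) : MvPolynomial (Fin n × σ) K)) (X i)) := by
    intro i k a c h
    rw [transl_X] at h
    rcases k with _ | k
    · simp only [Polynomial.coeff_add, Polynomial.coeff_C_zero, Polynomial.mul_coeff_zero,
        Polynomial.coeff_X_zero, zero_mul, add_zero, coeff_C] at h
      split_ifs at h with ha
      · rw [coeff_X] at h
        split_ifs at h with hc
        · subst hc
          simp [Finsupp.weight_single, groupWeight]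
        · exact absurd rfl h
      · simp at h
    · rw [Polynomial.coeff_add, Polynomial.coeff_C_succ, zero_add, Polynomial.coeff_X_mul,
        Polynomial.coeff_C] at h
      split_ifs at h with hk
      · rw [coeff_X] at h
        split_ifs at h with ha
        · rw [coeff_one] at h
          split_ifs at h with hc
          · subst hc; subst hk; simp
          · exact absurd rfl h
        · simp at h
      · simp at h
  have hpow : ∀ i m, Q m (transl (fun i => (X (j, i) : MvPolynomial (Fin n × σ) K)) (X i) ^ m) := by
    intro i m
    induction m with
    | zero => rw [pow_zero]; exact hone
    | succ m ih => rw [pow_succ]; exact hmul _ _ _ _ ih (hX i)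
  have hprod : ∀ s : Finset σ, Q (∑ i ∈ s, b i)
      (∏ i ∈ s, transl (fun i => (X (j, i) : MvPolynomial (Fin n × σ) K)) (X i) ^ b i) := by
    intro s
    induction s using Finset.induction_on with
    | empty => rw [Finset.sum_empty, Finset.prod_empty]; exact hone
    | insert i s hi ih =>
      rw [Finset.sum_insert hi, Finset.prod_insert hi]
      exact hmul _ _ _ _ (hpow i _) ih
  rw [monomial_eq, C_1, one_mul, Finsupp.prod, map_prod] at h
  simp_rw [map_pow] at h
  exact hprod b.support k a c h

theorem eval_smul_of_isWeightedHomogeneous {K : Type*} [Field K] [Fintype σ]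
    {f : MvPolynomial (Fin n × σ) K} {d : Fin n → ℕ}
    (hf : IsWeightedHomogeneous (groupWeight n σ) f d) (c : Fin n → K) (v : Fin n → σ → K) :
    eval (fun ji => c ji.1 * v ji.1 ji.2) f = (∏ j, c j ^ d j) * eval (fun ji => v ji.1 ji.2) f := by
  rw [eval_eq', eval_eq', Finset.mul_sum]
  refine Finset.sum_congr rfl fun e he => ?_
  have hd : ∀ j, ∑ i, e (j, i) = d j := by
    intro j
    rw [← hf (mem_support_iff.mp he), Finsupp.weight_apply, Finsupp.sum_fintype _ _ (by simp),
      Finset.sum_apply, Fintype.sum_prod_type]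
    simp [groupWeight, Pi.single_apply]
  simp_rw [mul_pow, Finset.prod_mul_distrib]
  rw [Fintype.prod_prod_type (fun x : Fin n × σ => c x.1 ^ e x)]
  simp_rw [Finset.prod_pow_eq_pow_sum, hd]
  ring

variable [Fintype σ] [DecidableEq σ]

def conditionMinor (K : Type*) [Field K] {M : Fin n → ℕ} {t : ℕ}
    (r : MonomialIndex σ t → ConditionIndex σ M) : MvPolynomial (Fin n × σ) K :=
  (Matrix.of fun a b : MonomialIndex σ t =>
    conditionEntry (fun j i => (X (j, i) : MvPolynomial (Fin n × σ) K)) (r a).1 b.1).det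

theorem aeval_conditionMinor {K A : Type*} [Field K] [CommRing A] [Algebra K A] {M : Fin n → ℕ}
    {t : ℕ} (r : MonomialIndex σ t → ConditionIndex σ M) (v : Fin n → σ → A) :
    aeval (fun ji : Fin n × σ => v ji.1 ji.2) (conditionMinor K r) =
      (Matrix.of fun a b : MonomialIndex σ t => conditionEntry v (r a).1 b.1).det := by
  rw [conditionMinor, AlgHom.map_det]
  congr 1
  ext a b
  have := map_conditionEntry
    (aeval (fun ji : Fin n × σ => v ji.1 ji.2) : MvPolynomial (Fin n × σ) K →ₐ[K] A).toRingHom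
    (fun j i => X (j, i)) (r a).1 b.1
  simpa using this

/-- The unknowns are the coefficients of the form, and the vanishing conditions are linear in them.
The minors are defined once over `K` and specialise to every domain over `K`, so one family of
polynomials decides the question for all of them. -/
theorem hasForm_iff (K : Type*) {A : Type*} [Field K] [CommRing A] [IsDomain A] [Algebra K A]
    (v : Fin n → σ → A) (M : Fin n → ℕ) (t : ℕ) :
    HasForm v M t ↔ ∀ r : MonomialIndex σ t → ConditionIndex σ M,
      aeval (fun ji : Fin n × σ => v ji.1 ji.2) (conditionMinor K r) = 0 := by
  simp_rw [aeval_conditionMinor]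
  rw [← exists_ne_zero_forall_sum_eq_zero_iff
    (fun (r : ConditionIndex σ M) (b : MonomialIndex σ t) => conditionEntry v r.1 b.1)]
  have key : ∀ x : MonomialIndex σ t → A,
      (∀ j, Polynomial.X ^ M j ∣ transl (v j) (∑ b, C (x b) * monomial b.1 1)) ↔
      ∀ r : ConditionIndex σ M, ∑ b, conditionEntry v r.1 b.1 * x b = 0 := by
    intro x
    have hc : ∀ j k a, ((transl (v j) (∑ b, C (x b) * monomial b.1 1)).coeff k).coeff a =
        ∑ b, conditionEntry v (j, k, a) b.1 * x b := by
      intro j k a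
      simp only [map_sum, map_mul, transl_C, Polynomial.finsetSum_coeff, Polynomial.coeff_C_mul,
        coeff_sum, coeff_C_mul, conditionEntry]
      exact Finset.sum_congr rfl fun b _ => mul_comm _ _
    constructor
    · rintro h ⟨⟨j, k, a⟩, hk⟩
      rw [← hc, Polynomial.X_pow_dvd_iff.mp (h j) k hk, coeff_zero]
    · intro h j
      refine Polynomial.X_pow_dvd_iff.mpr fun k hk => ext _ _ fun a => ?_
      rw [hc, coeff_zero]
      exact h ⟨(j, k, a), hk⟩
  have hcoeff : ∀ (x : MonomialIndex σ t → A) (b : MonomialIndex σ t),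
      coeff b.1 (∑ b, C (x b) * monomial b.1 1) = x b := by
    intro x b
    simp [coeff_sum, C_mul_monomial, coeff_monomial]
  have hmem : ∀ b : σ →₀ ℕ, b ∈ (Finset.univ : Finset σ).finsuppAntidiag t ↔ b.degree = t := by
    intro b
    rw [Finset.mem_finsuppAntidiag, Finsupp.degree_eq_sum]
    simp
  constructor
  · rintro ⟨F, hF0, hFt, hF⟩
    have hF' : F = ∑ b : MonomialIndex σ t, C (coeff b.1 F) * monomial b.1 1 := by
      ext d
      by_cases hd : d ∈ (Finset.univ : Finset σ).finsuppAntidiag t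
      · exact (hcoeff (fun b => coeff b.1 F) ⟨d, hd⟩).symm
      · rw [hFt.coeff_eq_zero (fun h => hd ((hmem d).mpr h)), coeff_sum]
        refine (Finset.sum_eq_zero fun b _ => ?_).symm
        rw [C_mul_monomial, coeff_monomial, if_neg]
        rintro rfl
        exact hd b.2
    refine ⟨fun b => coeff b.1 F, fun h0 => hF0 ?_, (key _).mp fun j => ?_⟩
    · rw [hF']
      exact Finset.sum_eq_zero fun b _ => by rw [show coeff b.1 F = 0 from congrFun h0 b]; simp
    · rw [← hF']
      exact hF j
  · rintro ⟨x, hx, h⟩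
    refine ⟨∑ b, C (x b) * monomial b.1 1, fun h0 => hx (funext fun b => ?_), ?_, (key x).mpr h⟩
    · rw [← hcoeff x b, h0]; simp
    · refine IsHomogeneous.sum _ _ _ fun b _ => ?_
      rw [C_mul_monomial]
      exact isHomogeneous_monomial _ ((hmem _).mp b.2)

/-- A row for a condition of order k at the j-th point has degree t − k in the j-th group, whatever
the column, so all terms of the determinant agree in degree. The truncated subtraction is harmless:
a nonzero entry forces k ≤ t. -/
theorem isWeightedHomogeneous_conditionMinor {K : Type*} [Field K] {M : Fin n → ℕ} {t : ℕ}
    (r : MonomialIndex σ t → ConditionIndex σ M) :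
    IsWeightedHomogeneous (groupWeight n σ) (conditionMinor K r)
      (∑ a, (t - (r a).1.2.1) • Pi.single (r a).1.1 1) := by
  rw [conditionMinor, Matrix.det_apply]
  refine IsWeightedHomogeneous.sum _ _ _ fun p _ => ?_
  rw [← Equiv.sum_comp p, Units.smul_def, ← Int.cast_smul_eq_zsmul K, smul_eq_C_mul]
  refine IsWeightedHomogeneous.C_mul (IsWeightedHomogeneous.prod _ _ _ fun a _ => ?_) _
  intro c hc
  have := weight_add_of_coeff_transl_monomial_ne_zero _ _ _ _ c hc
  have hdeg : a.1.degree = t := by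
    have := (Finset.mem_finsuppAntidiag.mp a.2).1
    rwa [Finsupp.degree_eq_sum]
  rw [hdeg] at this
  ext j
  have := congrFun this j
  simp only [Pi.add_apply, Pi.smul_apply, smul_eq_mul] at this ⊢
  rw [Nat.sub_mul]
  omega

end Minors

/-! ### Powers of the ideal of a point. -/

section PointIdeal

variable {K : Type*} [Field K] {N : ℕ}

theorem exists_sum_mul_rep_eq_one (p : PP K N) : ∃ l : Fin (N + 1) → K, ∑ i, l i * p.rep i = 1 := by
  obtain ⟨i, hi⟩ := Function.ne_iff.mp p.rep_nonzero
  refine ⟨Pi.single i (p.rep i)⁻¹, ?_⟩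
  rw [Finset.sum_eq_single i]
  · rw [Pi.single_eq_same]; exact inv_mul_cancel₀ hi
  · intro k _ hk; rw [Pi.single_eq_of_ne hk, zero_mul]
  · simp

theorem coeff_zero_transl {σ A : Type*} [CommRing A] (v : σ → A) (f : MvPolynomial σ A) :
    (transl v f).coeff 0 = C (eval v f) := by
  induction f using MvPolynomial.induction_on with
  | C a => simp
  | add p q hp hq => rw [map_add, map_add, Polynomial.coeff_add, hp, hq, map_add]
  | mul_X p i hp => rw [map_mul, map_mul, Polynomial.mul_coeff_zero, hp, transl_X]; simp

theorem isHomogeneous_linForm {σ A : Type*} [CommRing A] [Fintype σ] (l : σ → A) :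
    (linForm l).IsHomogeneous 1 :=
  IsHomogeneous.sum _ _ _ fun _ _ => isHomogeneous_C_mul_X _ _

theorem isHomogeneous_projCoord {σ A : Type*} [CommRing A] [Fintype σ] (l v : σ → A) (i : σ) :
    (projCoord l v i).IsHomogeneous 1 :=
  (isHomogeneous_X _ _).sub ((isHomogeneous_linForm l).C_mul _)

variable {p : PP K N} {l : Fin (N + 1) → K}

theorem pointIdeal_eq_span (hl : ∑ i, l i * p.rep i = 1) :
    pointIdeal p = Ideal.span (Set.range (projCoord l p.rep)) := by
  apply le_antisymm
  · rw [pointIdeal, Ideal.span_le]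
    rintro f ⟨⟨d, hd⟩, hf⟩
    have := (mem_span_projCoord_pow_iff (m := 1) hl).mpr
      (X_pow_dvd_homothety_of_transl hl hd (by
        rw [pow_one, Polynomial.X_dvd_iff, coeff_zero_transl, hf, map_zero]))
    rwa [pow_one] at this
  · rw [Ideal.span_le]
    rintro _ ⟨i, rfl⟩
    refine Ideal.subset_span ⟨⟨1, isHomogeneous_projCoord _ _ i⟩, ?_⟩
    rw [projCoord, map_sub, map_mul, eval_linForm, hl]
    simp

theorem mem_pointIdeal_pow_iff (hl : ∑ i, l i * p.rep i = 1) {f : CoordRing K N} {m : ℕ} :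
    f ∈ pointIdeal p ^ m ↔ Polynomial.X ^ m ∣ homothety l p.rep f := by
  rw [pointIdeal_eq_span hl, mem_span_projCoord_pow_iff hl]

theorem mem_pointIdeal_pow_iff_transl {f : CoordRing K N} {t : ℕ} (hf : f.IsHomogeneous t)
    (p : PP K N) (m : ℕ) : f ∈ pointIdeal p ^ m ↔ Polynomial.X ^ m ∣ transl p.rep f := by
  obtain ⟨l, hl⟩ := exists_sum_mul_rep_eq_one p
  rw [mem_pointIdeal_pow_iff hl]
  exact ⟨X_pow_dvd_transl_of_homothety hl, X_pow_dvd_homothety_of_transl hl hf⟩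

theorem pointIdeal_isPrime (p : PP K N) : (pointIdeal p).IsPrime := by
  obtain ⟨l, hl⟩ := exists_sum_mul_rep_eq_one p
  have hmem : ∀ f, f ∈ pointIdeal p ↔ Polynomial.X ∣ homothety l p.rep f := fun f => by
    have := mem_pointIdeal_pow_iff (f := f) (m := 1) hl
    rwa [pow_one, pow_one] at this
  refine ⟨fun h => ?_, fun {f g} h => ?_⟩
  · have := (hmem 1).mp (h ▸ Submodule.mem_top)
    rw [map_one] at this
    exact Polynomial.not_isUnit_X (isUnit_of_dvd_one this)
  · rw [hmem, map_mul] at h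
    rw [hmem, hmem]
    exact Polynomial.prime_X.dvd_or_dvd h

/-- Powers of a point ideal are primary: membership is divisibility of the expansion by a power of
the prime element `Polynomial.X`. -/
theorem mem_pointIdeal_pow_of_mul_mem {p : PP K N} {f u : CoordRing K N} {m : ℕ}
    (hu : u ∉ pointIdeal p) (h : u * f ∈ pointIdeal p ^ m) : f ∈ pointIdeal p ^ m := by
  obtain ⟨l, hl⟩ := exists_sum_mul_rep_eq_one p
  rw [mem_pointIdeal_pow_iff hl] at h ⊢
  rw [← pow_one (pointIdeal p), mem_pointIdeal_pow_iff hl, pow_one] at hu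
  rw [map_mul] at h
  exact Polynomial.prime_X.pow_dvd_of_dvd_mul_left _ hu h

/-- The k-th power of a nonzero `projCoord` works. If all of them were zero, the coordinates would
be proportional, which `0 < N` excludes. -/
theorem exists_mem_pointIdeal_pow_notMem_succ (hN : 0 < N) (p : PP K N) (k : ℕ) :
    ∃ y ∈ pointIdeal p ^ k, y ∉ pointIdeal p ^ (k + 1) := by
  obtain ⟨l, hl⟩ := exists_sum_mul_rep_eq_one p
  have : ∃ i, projCoord l p.rep i ≠ 0 := by
    by_contra! h
    have hX : ∀ i, (X i : CoordRing K N) = C (p.rep i) * linForm l := fun i =>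
      sub_eq_zero.mp (h i)
    have hne : (0 : Fin (N + 1)) ≠ Fin.last N := by
      simp [Fin.ext_iff]; omega
    have h1 : (C (p.rep (Fin.last N)) * X 0 : CoordRing K N) = C (p.rep 0) * X (Fin.last N) := by
      rw [hX 0, hX (Fin.last N)]; ring
    have h2 := congrArg (eval (Pi.single 0 1)) h1
    have h3 := congrArg (eval (Pi.single (Fin.last N) 1)) h1
    simp [hne, hne.symm] at h2 h3
    have := hX 0
    rw [← h3, map_zero, zero_mul] at this
    exact X_ne_zero _ this
  obtain ⟨i, hi⟩ := this
  refine ⟨projCoord l p.rep i ^ k, ?_, fun h => ?_⟩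
  · rw [pointIdeal_eq_span hl]
    exact Ideal.pow_mem_pow (Ideal.subset_span (Set.mem_range_self i)) k
  · rw [mem_pointIdeal_pow_iff hl, map_pow, homothety_projCoord hl, mul_pow, pow_succ,
      mul_dvd_mul_iff_left (pow_ne_zero _ Polynomial.X_ne_zero)] at h
    rw [← Polynomial.C_pow, Polynomial.X_dvd_iff, Polynomial.coeff_C_zero] at h
    exact pow_ne_zero k hi h

/-- The generators `projCoord` of the first ideal vanish at `q`, which says that `q` is a scalar
multiple of `p`. -/
theorem eq_of_pointIdeal_le {p q : PP K N} (h : pointIdeal p ≤ pointIdeal q) : p = q := by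
  obtain ⟨l, hl⟩ := exists_sum_mul_rep_eq_one p
  have hq : pointIdeal q ≤ RingHom.ker (eval q.rep) := by
    rw [pointIdeal, Ideal.span_le]
    exact fun f hf => hf.2
  rw [pointIdeal_eq_span hl] at h
  rw [← p.mk_rep, ← q.mk_rep]
  refine ((Projectivization.mk_eq_mk_iff' K _ _ _ _).mpr ⟨eval q.rep (linForm l), ?_⟩).symm
  ext i
  have := hq (h (Ideal.subset_span (Set.mem_range_self i)))
  rw [RingHom.mem_ker, projCoord, map_sub, map_mul, eval_X, eval_C, sub_eq_zero] at this
  rw [this, Pi.smul_apply, smul_eq_mul, mul_comm]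

end PointIdeal

/-! ### Associated primes and symbolic powers of fat point ideals. -/

section SymbolicPower

theorem mem_localContraction_iff {R : Type*} [CommRing R] {J P : Ideal R} (hP : P.IsPrime) {f : R} :
    f ∈ localContraction J P hP ↔ ∃ u, u ∉ P ∧ u * f ∈ J := by
  rw [localContraction, Ideal.mem_comap,
    IsLocalization.algebraMap_mem_map_algebraMap_iff P.primeCompl]
  rfl

variable {K : Type*} [Field K] {N n : ℕ} {p : Fin n → PP K N} {μ : Fin n → ℕ}

theorem mem_fatPointsIdeal {f : CoordRing K N} :
    f ∈ fatPointsIdeal p μ ↔ ∀ j, f ∈ pointIdeal (p j) ^ μ j := by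
  rw [fatPointsIdeal, Ideal.mem_iInf]

theorem exists_notMem_pointIdeal (hp : Function.Injective p) (μ : Fin n → ℕ) (j : Fin n) :
    ∃ u, u ∉ pointIdeal (p j) ∧ ∀ k, k ≠ j → u ∈ pointIdeal (p k) ^ μ k := by
  have h : ∀ k, ∃ g, k ≠ j → g ∈ pointIdeal (p k) ∧ g ∉ pointIdeal (p j) := by
    intro k
    by_cases hk : k = j
    · exact ⟨0, fun h => absurd hk h⟩
    · obtain ⟨g, hg⟩ := Set.not_subset.mp fun hle =>
        hk (hp (eq_of_pointIdeal_le (p := p k) (q := p j) hle))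
      exact ⟨g, fun _ => hg⟩
  choose g hg using h
  have := pointIdeal_isPrime (p j)
  refine ⟨∏ k ∈ Finset.univ.erase j, g k ^ μ k, fun h => ?_, fun k hk => ?_⟩
  · obtain ⟨k, hk, hk'⟩ := (Ideal.IsPrime.prod_mem_iff).mp h
    exact (hg k (Finset.ne_of_mem_erase hk)).2 (this.mem_of_pow_mem _ hk')
  · exact Ideal.mem_of_dvd _ (Finset.dvd_prod_of_mem _ (Finset.mem_erase.mpr ⟨hk, Finset.mem_univ k⟩))
      (Ideal.pow_mem_pow (hg k hk).1 _)

/-- An associated prime contains a product of powers of the point ideals, hence one of them. It lies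
in any point ideal at which its witness fails the order condition, and distinctness identifies the
two. Conversely, the class of u·y has annihilator the ideal of `p j`, where u separates `p j` from
the other points and y has order exactly `μ j - 1` there. -/
theorem mem_associatedPrimes_fatPointsIdeal_iff (hN : 0 < N) (hp : Function.Injective p)
    (hμ : ∀ j, 0 < μ j) (P : Ideal (CoordRing K N)) :
    P ∈ associatedPrimes (CoordRing K N) (CoordRing K N ⧸ fatPointsIdeal p μ) ↔
      ∃ j, P = pointIdeal (p j) := by
  have hcolon : ∀ x f : CoordRing K N,
      f ∈ (⊥ : Submodule (CoordRing K N) (CoordRing K N ⧸ fatPointsIdeal p μ)).colon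
        {Ideal.Quotient.mk _ x} ↔ ∀ j, f * x ∈ pointIdeal (p j) ^ μ j := by
    intro x f
    rw [Submodule.mem_colon_singleton, Submodule.mem_bot, ← mem_fatPointsIdeal,
      ← Ideal.Quotient.eq_zero_iff_mem, map_mul]
    rfl
  change IsAssociatedPrime _ _ ↔ _
  rw [isAssociatedPrime_iff]
  constructor
  · rintro ⟨hP, x, hx⟩
    obtain ⟨x, rfl⟩ := Ideal.Quotient.mk_surjective x
    have hmem : ∀ f, f ∈ P ↔ ∀ j, f * x ∈ pointIdeal (p j) ^ μ j := fun f => by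
      rw [← hcolon, ← hx]
    obtain ⟨k, hk⟩ : ∃ k, x ∉ pointIdeal (p k) ^ μ k := by
      by_contra! h
      exact hP.ne_top ((Ideal.eq_top_iff_one _).mpr ((hmem 1).mpr (by simpa using h)))
    have hle : P ≤ pointIdeal (p k) := fun f hf => by
      by_contra hfk
      exact hk (mem_pointIdeal_pow_of_mul_mem hfk ((hmem f).mp hf k))
    have hprod : ∏ j, pointIdeal (p j) ^ μ j ≤ P := by
      refine fun f hf => (hmem f).mpr fun j => Ideal.mul_mem_right _ _ ?_
      exact (Ideal.prod_le_inf.trans (Finset.inf_le (Finset.mem_univ j))) hf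
    obtain ⟨j, _, hj⟩ := (hP.prod_le).mp hprod
    have hj' := hP.le_of_pow_le hj
    obtain rfl : j = k := hp (eq_of_pointIdeal_le (hj'.trans hle))
    exact ⟨j, le_antisymm hle hj'⟩
  · rintro ⟨j, rfl⟩
    refine ⟨pointIdeal_isPrime _, ?_⟩
    obtain ⟨u, hu, hu'⟩ := exists_notMem_pointIdeal hp μ j
    obtain ⟨y, hy, hy'⟩ := exists_mem_pointIdeal_pow_notMem_succ hN (p j) (μ j - 1)
    have hμj : μ j - 1 + 1 = μ j := Nat.sub_add_cancel (hμ j)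
    rw [hμj] at hy'
    refine ⟨Ideal.Quotient.mk _ (u * y), Ideal.ext fun f => ?_⟩
    rw [hcolon]
    constructor
    · intro hf k
      by_cases hk : k = j
      · subst hk
        rw [mul_left_comm, ← hμj, pow_succ']
        exact Ideal.mul_mem_left _ _ (Ideal.mul_mem_mul hf hy)
      · rw [mul_left_comm]
        exact Ideal.mul_mem_right _ _ (hu' k hk)
    · intro h
      by_contra hf
      have := h j
      rw [← mul_assoc] at this
      refine hy' (mem_pointIdeal_pow_of_mul_mem (fun hm => ?_) this)
      exact ((pointIdeal_isPrime (p j)).mem_or_mem hm).elim hf hu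

/-- Localizing at `p j` inverts an element u that lies in the other components, so I there equals
the `μ j`-th power of the point ideal. Primariness brings the condition back to the ring. -/
theorem symbolicPower_fatPointsIdeal (hN : 0 < N) (hp : Function.Injective p)
    (hμ : ∀ j, 0 < μ j) (m : ℕ) :
    symbolicPower (fatPointsIdeal p μ) m = fatPointsIdeal p fun j => m * μ j := by
  have hiff := mem_associatedPrimes_fatPointsIdeal_iff hN hp hμ
  ext f
  rw [symbolicPower, Ideal.mem_iInf, mem_fatPointsIdeal]
  constructor
  · intro h j
    obtain ⟨u, hu, huf⟩ := (mem_localContraction_iff _).mp (h ⟨_, (hiff _).mpr ⟨j, rfl⟩⟩)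
    refine mem_pointIdeal_pow_of_mul_mem hu ?_
    rw [mul_comm m, pow_mul]
    exact Ideal.pow_right_mono (iInf_le _ j) m huf
  · rintro h ⟨P, hP⟩
    obtain ⟨j, rfl⟩ := (hiff P).mp hP
    rw [mem_localContraction_iff]
    obtain ⟨u, hu, hu'⟩ := exists_notMem_pointIdeal hp μ j
    refine ⟨u ^ m, fun hm => hu ((pointIdeal_isPrime (p j)).mem_of_pow_mem _ hm), ?_⟩
    have hle : Ideal.span {u} * pointIdeal (p j) ^ μ j ≤ fatPointsIdeal p μ := by
      refine le_iInf fun k => ?_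
      by_cases hk : k = j
      · subst hk; exact Ideal.mul_le_right (I := Ideal.span {u})
      · exact Ideal.mul_le_left.trans
          ((Ideal.span_singleton_le_iff_mem _).mpr (hu' k hk))
    refine Ideal.pow_right_mono hle m ?_
    rw [mul_pow, ← pow_mul, mul_comm (μ j)]
    exact Ideal.mul_mem_mul (Ideal.pow_mem_pow (Ideal.mem_span_singleton_self u) m) (h j)

end SymbolicPower

/-! ### Generic least degrees and existence of the limit. -/

section HasForm

variable {K : Type*} [Field K] {N n : ℕ}

theorem HasForm.mul {σ A : Type*} [CommRing A] [IsDomain A] {v : Fin n → σ → A}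
    {M M' : Fin n → ℕ} {t t' : ℕ} (h : HasForm v M t) (h' : HasForm v M' t') :
    HasForm v (fun j => M j + M' j) (t + t') := by
  obtain ⟨F, hF, hFt, hFv⟩ := h
  obtain ⟨G, hG, hGt, hGv⟩ := h'
  refine ⟨F * G, mul_ne_zero hF hG, hFt.mul hGt, fun j => ?_⟩
  rw [map_mul, pow_add]
  exact mul_dvd_mul (hFv j) (hGv j)

theorem HasForm.mono {v : Fin n → Fin (N + 1) → K} {M : Fin n → ℕ} {t t' : ℕ}
    (h : HasForm v M t) (htt' : t ≤ t') : HasForm v M t' := by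
  have h0 : HasForm v (fun _ => 0) (t' - t) :=
    ⟨X 0 ^ (t' - t), pow_ne_zero _ (X_ne_zero _), isHomogeneous_X_pow _ _, fun j => by simp⟩
  have := h.mul h0
  rwa [Nat.add_sub_cancel' htt'] at this

/-- A product of powers of linear forms through the vectors. It shows that the infimum defining
`genericAlpha` is attained. -/
theorem hasForm_sum (hN : 0 < N) (v : Fin n → Fin (N + 1) → K) (M : Fin n → ℕ) :
    HasForm v M (∑ j, M j) := by
  have hne : (0 : Fin (N + 1)) ≠ Fin.last N := by
    simp [Fin.ext_iff]; omega
  have h : ∀ j, ∃ F : MvPolynomial (Fin (N + 1)) K, F ≠ 0 ∧ F.IsHomogeneous 1 ∧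
      eval (v j) F = 0 := by
    intro j
    by_cases h0 : v j 0 = 0
    · exact ⟨X 0, X_ne_zero _, isHomogeneous_X _ _, by simpa using h0⟩
    · refine ⟨C (v j (Fin.last N)) * X 0 - C (v j 0) * X (Fin.last N), fun h => h0 ?_,
        (isHomogeneous_C_mul_X _ _).sub (isHomogeneous_C_mul_X _ _), ?_⟩
      · have := congrArg (eval (Pi.single (Fin.last N) 1)) h
        simpa [hne, hne.symm] using this
      · simp [mul_comm]
  choose F hF hF1 hFv using h
  refine ⟨∏ j, F j ^ M j, Finset.prod_ne_zero_iff.mpr fun j _ => pow_ne_zero _ (hF j), ?_,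
    fun j => ?_⟩
  · refine IsHomogeneous.prod _ _ _ fun j _ => ?_
    simpa using (hF1 j).pow (M j)
  · rw [map_prod]
    refine dvd_trans ?_ (Finset.dvd_prod_of_mem _ (Finset.mem_univ j))
    rw [map_pow]
    refine pow_dvd_pow_of_dvd ?_ _
    rw [Polynomial.X_dvd_iff, coeff_zero_transl, hFv, map_zero]

theorem alpha_fatPointsIdeal (p : Fin n → PP K N) (M : Fin n → ℕ) :
    alpha (fatPointsIdeal p M) = sInf {t | HasForm (fun j => (p j).rep) M t} := by
  rw [alpha]
  congr 1
  ext t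
  constructor
  · rintro ⟨f, hf, h0, ht⟩
    exact ⟨f, h0, ht, fun j =>
      (mem_pointIdeal_pow_iff_transl ht _ _).mp (mem_fatPointsIdeal.mp hf j)⟩
  · rintro ⟨f, h0, ht, hf⟩
    exact ⟨f, mem_fatPointsIdeal.mpr fun j => (mem_pointIdeal_pow_iff_transl ht _ _).mpr (hf j),
      h0, ht⟩

/-- The least degree in which every system of `n` vectors admits a form with the prescribed orders
of vanishing. -/
def genericAlpha (K : Type*) [Field K] (N : ℕ) (M : Fin n → ℕ) : ℕ :=
  sInf {t | ∀ v : Fin n → Fin (N + 1) → K, HasForm v M t}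

theorem hasForm_genericAlpha (hN : 0 < N) (M : Fin n → ℕ) (v : Fin n → Fin (N + 1) → K) :
    HasForm v M (genericAlpha K N M) :=
  Nat.sInf_mem (s := {t | ∀ v : Fin n → Fin (N + 1) → K, HasForm v M t})
    ⟨_, fun v => hasForm_sum hN v M⟩ v

/-- One degree below the generic value some system has no form, so some minor is nonzero there.
Where that minor does not vanish, `HasForm.mono` excludes all lower degrees too. -/
theorem exists_multihomogeneous_of_lt_genericAlpha (M : Fin n → ℕ) :
    ∃ (F : MvPolynomial (Fin n × Fin (N + 1)) K) (d : Fin n → ℕ), F ≠ 0 ∧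
      IsWeightedHomogeneous (groupWeight n (Fin (N + 1))) F d ∧
      ∀ v : Fin n → Fin (N + 1) → K, ∀ t < genericAlpha K N M, HasForm v M t →
        eval (fun ji => v ji.1 ji.2) F = 0 := by
  rcases Nat.eq_zero_or_pos (genericAlpha K N M) with h0 | hpos
  · exact ⟨1, 0, one_ne_zero, isWeightedHomogeneous_one _ _, fun v t ht => by omega⟩
  · have hnot : ¬ ∀ v : Fin n → Fin (N + 1) → K, HasForm v M (genericAlpha K N M - 1) := fun h => by
      have : genericAlpha K N M ≤ genericAlpha K N M - 1 := Nat.sInf_le h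
      omega
    push Not at hnot
    obtain ⟨v, hv⟩ := hnot
    rw [hasForm_iff K] at hv
    push Not at hv
    obtain ⟨r, hr⟩ := hv
    refine ⟨conditionMinor K r, _, fun h => hr (by rw [h, map_zero]),
      isWeightedHomogeneous_conditionMinor r, fun w t ht hw => ?_⟩
    exact (hasForm_iff K w M _).mp (hw.mono (by omega)) r

/-- A multihomogeneous polynomial whose nonvanishing forces the points to be pairwise distinct. -/
def distinctPoly (K : Type*) [Field K] (N n : ℕ) : MvPolynomial (Fin n × Fin (N + 1)) K :=
  ∏ x ∈ (Finset.univ : Finset (Fin n)).offDiag,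
    (X (x.1, 0) * X (x.2, Fin.last N) - X (x.1, Fin.last N) * X (x.2, 0))

theorem isWeightedHomogeneous_groupWeight_X (j : Fin n) (i : Fin (N + 1)) :
    IsWeightedHomogeneous (groupWeight n (Fin (N + 1)))
      (X (j, i) : MvPolynomial (Fin n × Fin (N + 1)) K) (Pi.single j 1) :=
  isWeightedHomogeneous_X K (groupWeight n (Fin (N + 1))) (j, i)

theorem isWeightedHomogeneous_distinctPoly :
    IsWeightedHomogeneous (groupWeight n (Fin (N + 1))) (distinctPoly K N n)
      (∑ x ∈ (Finset.univ : Finset (Fin n)).offDiag, (Pi.single x.1 1 + Pi.single x.2 1)) := by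
  refine IsWeightedHomogeneous.prod _ _ _ fun x _ => ?_
  exact ((isWeightedHomogeneous_groupWeight_X _ _).mul
    (isWeightedHomogeneous_groupWeight_X _ _)).sub
    ((isWeightedHomogeneous_groupWeight_X _ _).mul (isWeightedHomogeneous_groupWeight_X _ _))

theorem distinctPoly_ne_zero (hN : 0 < N) : distinctPoly K N n ≠ 0 := by
  have hne : (0 : Fin (N + 1)) ≠ Fin.last N := by
    simp [Fin.ext_iff]; omega
  refine Finset.prod_ne_zero_iff.mpr fun x hx h => ?_
  have hx' := (Finset.mem_offDiag.mp hx).2.2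
  have := congrArg (eval fun ji : Fin n × Fin (N + 1) =>
    if ji = (x.1, 0) ∨ ji = (x.2, Fin.last N) then (1 : K) else 0) h
  simp [hne.symm, hx'] at this

theorem injective_of_eval_distinctPoly_ne_zero {p : Fin n → PP K N}
    (h : eval (fun ji => (p ji.1).rep ji.2) (distinctPoly K N n) ≠ 0) : Function.Injective p := by
  intro j k hjk
  by_contra hne
  rw [distinctPoly, map_prod] at h
  refine Finset.prod_ne_zero_iff.mp h (j, k)
    (Finset.mem_offDiag.mpr ⟨Finset.mem_univ _, Finset.mem_univ _, hne⟩) ?_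
  simp [hjk, mul_comm]

theorem isZariskiOpen_ne_zero {F : MvPolynomial (Fin n × Fin (N + 1)) K} {d : Fin n → ℕ}
    (hF : IsWeightedHomogeneous (groupWeight n (Fin (N + 1))) F d) :
    IsZariskiOpen {p : Fin n → PP K N | eval (fun ji => (p ji.1).rep ji.2) F ≠ 0} :=
  ⟨{F}, fun f hf => ⟨d, by
    rw [Set.mem_singleton_iff.mp hf]
    exact isMultihomogeneous_of_isWeightedHomogeneous hF⟩, by ext p; simp⟩

theorem exists_eval_rep_ne_zero [Infinite K] {F : MvPolynomial (Fin n × Fin (N + 1)) K}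
    {d : Fin n → ℕ} (hF : IsWeightedHomogeneous (groupWeight n (Fin (N + 1))) F d) (h0 : F ≠ 0) :
    {p : Fin n → PP K N | eval (fun ji => (p ji.1).rep ji.2) F ≠ 0}.Nonempty := by
  -- The extra factor makes every vector nonzero, so that it defines a point. Passing to the chosen
  -- representatives rescales by units, which multihomogeneity absorbs.
  have hne : F * ∏ j, X (j, 0) ≠ 0 :=
    mul_ne_zero h0 (Finset.prod_ne_zero_iff.mpr fun j _ => X_ne_zero _)
  obtain ⟨v, hv⟩ : ∃ v, eval v (F * ∏ j, X (j, 0)) ≠ 0 := by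
    by_contra! h
    exact hne (MvPolynomial.funext fun v => by rw [h v, map_zero])
  rw [map_mul, map_prod] at hv
  have hv0 : ∀ j, (fun i => v (j, i)) ≠ 0 := fun j h => by
    refine Finset.prod_ne_zero_iff.mp (right_ne_zero_of_mul hv) j (Finset.mem_univ j) ?_
    rw [eval_X]
    exact congrFun h 0
  choose c hc using fun j => Projectivization.exists_smul_eq_mk_rep K (fun i => v (j, i)) (hv0 j)
  refine ⟨fun j => Projectivization.mk K _ (hv0 j), ?_⟩
  have := eval_smul_of_isWeightedHomogeneous hF (fun j => (c j : K)) fun j i => v (j, i)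
  have he : (fun ji : Fin n × Fin (N + 1) => (Projectivization.mk K _ (hv0 ji.1)).rep ji.2) =
      fun ji => (c ji.1 : K) * v (ji.1, ji.2) := by
    ext ji
    rw [← hc]
    rfl
  change eval (fun ji : Fin n × Fin (N + 1) => (Projectivization.mk K _ (hv0 ji.1)).rep ji.2) F ≠ 0
  rw [he, this]
  exact mul_ne_zero (Finset.prod_ne_zero_iff.mpr fun j _ => pow_ne_zero _ (c j).ne_zero)
    (left_ne_zero_of_mul hv)

/-- The generic Waldschmidt constant exists, and is bounded below by any uniform lower bound for
the degrees in which all systems of vectors admit forms. -/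
theorem exists_isGenericWaldschmidtConstant [Infinite K] (hN : 0 < N) {μ : Fin n → ℕ}
    (hμ : ∀ j, 0 < μ j) (c : ℝ) (hc : ∀ m t : ℕ,
      (∀ v : Fin n → Fin (N + 1) → K, HasForm v (fun j => m * μ j) t) → c * m ≤ t) :
    ∃ g : ℝ, IsGenericWaldschmidtConstant K N μ g ∧ c ≤ g := by
  obtain ⟨a, hadef⟩ : ∃ a : ℕ → ℕ, ∀ m, a m = genericAlpha K N fun j => m * μ j := ⟨_, fun _ => rfl⟩
  have ha : ∀ m (v : Fin n → Fin (N + 1) → K), HasForm v (fun j => m * μ j) (a m) := fun m v => by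
    rw [hadef]
    exact hasForm_genericAlpha hN _ v
  have hsub : Subadditive fun m => (a m : ℝ) := by
    intro m k
    have : a (m + k) ≤ a m + a k := by
      rw [hadef (m + k)]
      refine Nat.sInf_le fun v => ?_
      simpa only [add_mul] using (ha m v).mul (ha k v)
    change ((a (m + k) : ℕ) : ℝ) ≤ a m + a k
    exact_mod_cast this
  have hlim := hsub.tendsto_lim ⟨0, by rintro _ ⟨m, rfl⟩; positivity⟩
  choose F d hF0 hFd hF using fun m => exists_multihomogeneous_of_lt_genericAlpha (K := K) (N := N)
    (fun j : Fin n => m * μ j)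
  have hd' := isWeightedHomogeneous_distinctPoly (K := K) (N := N) (n := n)
  -- The first factor excludes forms below the generic degree; the second keeps the points distinct,
  -- as the formula for the symbolic power requires.
  let U : ℕ → Set (Fin n → PP K N) := fun m =>
    {p | eval (fun ji => (p ji.1).rep ji.2) (F m * distinctPoly K N n) ≠ 0}
  have hU : ∀ m, ∀ p ∈ U m, alpha (symbolicPower (fatPointsIdeal p μ) m) = a m := by
    intro m p hp
    change eval _ _ ≠ 0 at hp
    rw [map_mul] at hp
    rw [symbolicPower_fatPointsIdeal hN
      (injective_of_eval_distinctPoly_ne_zero (right_ne_zero_of_mul hp)) hμ, alpha_fatPointsIdeal]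
    refine le_antisymm (Nat.sInf_le (ha m _)) (le_csInf ⟨_, ha m _⟩ fun t ht => ?_)
    by_contra! hlt
    exact left_ne_zero_of_mul hp (hF m (fun j => (p j).rep) t (hadef m ▸ hlt) ht)
  refine ⟨hsub.lim, ⟨U, a, fun m => ⟨isZariskiOpen_ne_zero ((hFd m).mul hd'),
    exists_eval_rep_ne_zero ((hFd m).mul hd') (mul_ne_zero (hF0 m) (distinctPoly_ne_zero hN))⟩,
    hU, hlim, fun p hp => ?_⟩, ?_⟩
  · refine hlim.congr fun m => ?_
    rw [hU m p (Set.mem_iInter.mp hp m)]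
  · refine ge_of_tendsto hlim (eventually_atTop.mpr ⟨1, fun m hm => ?_⟩)
    rw [le_div_iff₀ (by exact_mod_cast hm)]
    exact hc m (a m) (ha m)

end HasForm

/-! ### Bézout on a twisted cubic through the five base points. -/

section TwistedCubic

/-- At the parameter `r` the curve meets the line spanned by `w`, so every generator `projCoord`
pulls back to a polynomial with root `r`. -/
theorem X_sub_C_pow_dvd_aeval {σ K : Type*} [Fintype σ] [Field K] {l w : σ → K}
    (hlw : ∑ i, l i * w i = 1) {f : MvPolynomial σ K} {m : ℕ}
    (hf : Polynomial.X ^ m ∣ homothety l w f) (c : σ → Polynomial K) (r u : K)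
    (hc : ∀ i, (c i).eval r = u * w i) :
    (Polynomial.X - Polynomial.C r) ^ m ∣ aeval c f := by
  have hle : Ideal.span (Set.range (projCoord l w)) ≤
      (Ideal.span {Polynomial.X - Polynomial.C r}).comap
        (aeval c : MvPolynomial σ K →ₐ[K] Polynomial K) := by
    rw [Ideal.span_le]
    rintro _ ⟨i, rfl⟩
    refine Ideal.mem_span_singleton.mpr (Polynomial.dvd_iff_isRoot.mpr ?_)
    have hsum : ∑ i, l i * (u * w i) = u := by
      simp_rw [mul_left_comm _ u, ← Finset.mul_sum, hlw, mul_one]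
    simp [projCoord, linForm, Polynomial.eval_finsetSum, hc, hsum, mul_comm]
  have := (Ideal.pow_right_mono hle m).trans (Ideal.le_comap_pow _ m)
    ((mem_span_projCoord_pow_iff hlw).mpr hf)
  rwa [Ideal.mem_comap, Ideal.span_singleton_pow, Ideal.mem_span_singleton] at this

/-- The four coordinate points and the unit point of `ℙ³`, with coordinate sum `1`. -/
def basePt (K : Type*) [Field K] (j : Fin 5) (i : Fin 4) : K :=
  if j = Fin.last 4 then 4⁻¹ else if i.castSucc = j then 1 else 0

variable {K : Type*} [Field K] [CharZero K]

theorem sum_basePt (j : Fin 5) : ∑ i, 1 * basePt K j i = 1 := by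
  induction j using Fin.lastCases with
  | last => simp [basePt]
  | cast j => simp [basePt]

/-- A nonzero polynomial of degree at most `d` meets a general twisted cubic through the five base
points in at most `3 * d` points. -/
theorem sum_le_three_mul_of_dvd_homothety {f : MvPolynomial (Fin 4) K} (hf : f ≠ 0) {d : ℕ}
    (hd : f.totalDegree ≤ d) (m : Fin 5 → ℕ)
    (hm : ∀ j, Polynomial.X ^ m j ∣ homothety (fun _ => 1) (basePt K j) f) :
    ∑ j, m j ≤ 3 * d := by
  -- The sixth point `b` avoids the zeros of `f`. Its coordinates are distinct and different from 0
  -- and 1, which makes the five parameters `r` distinct.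
  obtain ⟨b, hb⟩ : ∃ b : Fin 4 → K, eval b (f * (∏ i, X i) * (∏ i, (1 - X i)) *
      ∏ x ∈ (Finset.univ : Finset (Fin 4)).offDiag, (X x.1 - X x.2)) ≠ 0 := by
    by_contra! h
    refine mul_ne_zero (mul_ne_zero (mul_ne_zero hf ?_) ?_) ?_
      (MvPolynomial.funext fun b => by rw [h b, map_zero])
    · exact Finset.prod_ne_zero_iff.mpr fun i _ => X_ne_zero _
    · refine Finset.prod_ne_zero_iff.mpr fun i _ h => ?_
      simpa using congrArg (eval 0) h
    · refine Finset.prod_ne_zero_iff.mpr fun x hx h => (Finset.mem_offDiag.mp hx).2.2 ?_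
      exact X_injective (sub_eq_zero.mp h)
  simp only [map_mul, map_prod, map_sub, map_one, eval_X] at hb
  have hb0 : ∀ i, b i ≠ 0 := fun i =>
    Finset.prod_ne_zero_iff.mp (right_ne_zero_of_mul (left_ne_zero_of_mul (left_ne_zero_of_mul hb)))
      i (Finset.mem_univ i)
  have hb1 : ∀ i, 1 - b i ≠ 0 := fun i =>
    Finset.prod_ne_zero_iff.mp (right_ne_zero_of_mul (left_ne_zero_of_mul hb)) i (Finset.mem_univ i)
  have hbinj : Function.Injective b := fun i j hij => by
    by_contra hne
    exact Finset.prod_ne_zero_iff.mp (right_ne_zero_of_mul hb) (i, j)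
      (Finset.mem_offDiag.mpr ⟨Finset.mem_univ _, Finset.mem_univ _, hne⟩) (sub_eq_zero.mpr hij)
  have hfb : eval b f ≠ 0 := left_ne_zero_of_mul (left_ne_zero_of_mul (left_ne_zero_of_mul hb))
  -- This cubic passes through `b` at 0, through a multiple of the unit point at 1, and through a
  -- multiple of the i-th coordinate point at `(1 - b i)⁻¹`, where all other coordinates vanish.
  let c : Fin 4 → Polynomial K := fun i => Polynomial.C (b i) *
    ∏ j ∈ Finset.univ.erase i, (1 - Polynomial.C (1 - b j) * Polynomial.X)
  let r : Fin 5 → K := Fin.snoc (α := fun _ => K) (fun i => (1 - b i)⁻¹) 1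
  have hrinj : Function.Injective r := by
    intro i j h
    induction i using Fin.lastCases with
    | last =>
      induction j using Fin.lastCases with
      | last => rfl
      | cast j =>
        simp only [r, Fin.snoc_last, Fin.snoc_castSucc] at h
        exact absurd (by simpa using h.symm) (hb0 j)
    | cast i =>
      induction j using Fin.lastCases with
      | last =>
        simp only [r, Fin.snoc_last, Fin.snoc_castSucc] at h
        exact absurd (by simpa using h) (hb0 i)
      | cast j =>
        simp only [r, Fin.snoc_castSucc, inv_inj, sub_right_inj] at h
        rw [hbinj h]
  have hdvd : ∀ j, (Polynomial.X - Polynomial.C (r j)) ^ m j ∣ aeval c f := by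
    intro j
    induction j using Fin.lastCases with
    | last =>
      refine X_sub_C_pow_dvd_aeval (sum_basePt _) (hm _) c _ (4 * ∏ j, b j) fun i => ?_
      simp only [r, c, basePt, Fin.snoc_last, Polynomial.eval_mul, Polynomial.eval_C,
        Polynomial.eval_prod, Polynomial.eval_sub, Polynomial.eval_one, Polynomial.eval_X, mul_one,
        sub_sub_cancel, if_true]
      rw [Finset.mul_prod_erase _ _ (Finset.mem_univ i), mul_comm (4 : K),
        mul_inv_cancel_right₀ (by norm_num)]
    | cast j =>
      refine X_sub_C_pow_dvd_aeval (sum_basePt _) (hm _) c _ ((c j).eval (r j.castSucc))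
        fun i => ?_
      simp only [basePt, (Fin.castSucc_lt_last j).ne, if_false, Fin.castSucc_inj]
      split_ifs with hij
      · rw [hij, mul_one]
      · rw [mul_zero]
        simp only [c, Polynomial.eval_mul, Polynomial.eval_prod]
        rw [Finset.prod_eq_zero (Finset.mem_erase.mpr ⟨Ne.symm hij, Finset.mem_univ j⟩), mul_zero]
        simp [r, Fin.snoc_castSucc, mul_inv_cancel₀ (hb1 j)]
  have hprod : ∏ j, (Polynomial.X - Polynomial.C (r j)) ^ m j ∣ aeval c f :=
    Finset.prod_dvd_of_coprime
      (fun i _ j _ hij => (Polynomial.pairwise_coprime_X_sub_C hrinj hij).pow) fun j _ => hdvd j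
  have hne : aeval c f ≠ 0 := by
    intro h
    apply hfb
    have h1 := congrArg (Polynomial.eval 0) h
    have h2 : ∀ g : MvPolynomial (Fin 4) K, (aeval c g).eval 0 = eval b g := by
      intro g
      induction g using MvPolynomial.induction_on with
      | C a => simp
      | add p q hp hq => rw [map_add, Polynomial.eval_add, hp, hq, map_add]
      | mul_X p i hp =>
        rw [map_mul, Polynomial.eval_mul, hp, map_mul, aeval_X, eval_X]
        simp [c, Polynomial.eval_prod]
    rwa [h2, Polynomial.eval_zero] at h1
  have hdeg : (aeval c f).natDegree ≤ d * 3 := by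
    refine aeval_natDegree_le f hd c fun i => (Polynomial.natDegree_C_mul_le _ _).trans ?_
    refine (Polynomial.natDegree_prod_le _ _).trans ((Finset.sum_le_card_nsmul _ _ 1 ?_).trans ?_)
    · exact fun j _ => by compute_degree
    · simp
  have := Polynomial.natDegree_le_of_dvd hprod hne
  rw [Polynomial.natDegree_prod _ _ fun j _ => pow_ne_zero _ (Polynomial.X_sub_C_ne_zero _)] at this
  simp only [Polynomial.natDegree_pow, Polynomial.natDegree_X_sub_C, mul_one] at this
  omega

end TwistedCubic

/-! ### Limits of forms at colliding points. -/

section Collision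

theorem homothety_map {σ A B : Type*} [Fintype σ] [CommRing A] [CommRing B] (φ : A →+* B)
    (l v : σ → A) (f : MvPolynomial σ A) :
    homothety (fun i => φ (l i)) (fun i => φ (v i)) (map φ f) =
      (homothety l v f).map (map φ) := by
  have hL : linForm (fun i => φ (l i)) = map φ (linForm l) := by simp [linForm]
  induction f using MvPolynomial.induction_on with
  | C a => simp
  | add p q hp hq => rw [map_add, map_add, map_add, Polynomial.map_add, hp, hq]
  | mul_X p i hp =>
    rw [map_mul, map_mul, map_mul, Polynomial.map_mul, hp, map_X, homothety_X, homothety_X]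
    simp [projCoord, hL]

theorem X_pow_dvd_of_dvd_C_mul {R : Type*} [CommRing R] [IsDomain R] {a : R} (ha : a ≠ 0)
    {P : Polynomial R} {m : ℕ} (h : Polynomial.X ^ m ∣ Polynomial.C a * P) :
    Polynomial.X ^ m ∣ P := by
  rw [Polynomial.X_pow_dvd_iff] at h ⊢
  intro k hk
  have := h k hk
  rw [Polynomial.coeff_C_mul] at this
  exact (mul_eq_zero.mp this).resolve_left ha

theorem exists_eq_C_X_pow_mul {σ K : Type*} [Finite σ] [Field K]
    {F : MvPolynomial σ (Polynomial K)} (hF : F ≠ 0) :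
    ∃ (e : ℕ) (G : MvPolynomial σ (Polynomial K)), F = C (Polynomial.X ^ e) * G ∧
      map Polynomial.constantCoeff G ≠ 0 := by
  have hu : ¬ IsUnit (C Polynomial.X : MvPolynomial σ (Polynomial K)) := fun h => by
    have := h.map (map (σ := σ) (Polynomial.constantCoeff (R := K)))
    simp at this
  obtain ⟨e, G, hG, h⟩ := WfDvdMonoid.max_power_factor' hF hu
  refine ⟨e, G, by rw [C_pow]; exact h, fun h0 => hG ?_⟩
  rw [C_dvd_iff_dvd_coeff]
  intro i
  have := congrArg (coeff i) h0
  rw [coeff_map, coeff_zero] at this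
  exact Polynomial.X_dvd_iff.mpr this

theorem isHomogeneous_of_C_mul {σ A : Type*} [CommRing A] [IsDomain A] {a : A} (ha : a ≠ 0)
    {G : MvPolynomial σ A} {t : ℕ} (h : (C a * G).IsHomogeneous t) : G.IsHomogeneous t := by
  intro d hd
  refine h ?_
  rw [coeff_C_mul]
  exact mul_ne_zero ha hd

/-- Substitution of `s = a` in the expansion along homotheties. -/
theorem eval_C_homothety {σ A : Type*} [Fintype σ] [CommRing A] (l v : σ → A)
    (f : MvPolynomial σ A) (a : A) :
    (homothety l v f).eval (C a) =
      aeval (fun i => C (v i) * linForm l + C a * projCoord l v i) f := by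
  induction f using MvPolynomial.induction_on with
  | C b => simp
  | add p q hp hq => rw [map_add, map_add, Polynomial.eval_add, hp, hq]
  | mul_X p i hp =>
    rw [map_mul, map_mul, Polynomial.eval_mul, hp, homothety_X, aeval_X, Polynomial.eval_add,
      Polynomial.eval_mul, Polynomial.eval_C, Polynomial.eval_C, Polynomial.eval_X]

/-- On the affine hyperplane where `l` is 1, the homothety of ratio `a` carries `q` to v + a(q − v).
Orders of vanishing at the image therefore pull back to `q`. -/
theorem transl_eval_C_homothety {σ A : Type*} [Fintype σ] [CommRing A] {l v q : σ → A}
    (hq : ∑ i, l i * q i = 1) (f : MvPolynomial σ A) (a : A) :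
    transl q ((homothety l v f).eval (C a)) =
      (transl (fun i => v i + a * (q i - v i)) f).map
        (aeval (fun i => C (v i) * linForm l + C a * projCoord l v i) :
          MvPolynomial σ A →ₐ[A] MvPolynomial σ A).toRingHom := by
  have hL : transl q (linForm l) = 1 + Polynomial.X * Polynomial.C (linForm l) := by
    simp_rw [linForm, map_sum, map_mul, transl_X, transl_C, mul_add, Finset.sum_add_distrib,
      mul_left_comm _ Polynomial.X, ← Finset.mul_sum, ← Polynomial.C_mul, ← C_mul]
    rw [← map_sum, ← map_sum, hq]
    simp
  rw [eval_C_homothety]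
  induction f using MvPolynomial.induction_on with
  | C b => simp
  | add p q hp hq => rw [map_add, map_add, map_add, Polynomial.map_add, hp, hq]
  | mul_X p i hp =>
    rw [map_mul, map_mul, map_mul, Polynomial.map_mul, hp, aeval_X, transl_X]
    congr 1
    have hX : (aeval (fun i => C (v i) * linForm l + C a * projCoord l v i) :
        MvPolynomial σ A →ₐ[A] MvPolynomial σ A).toRingHom (X i) =
          C (v i) * linForm l + C a * projCoord l v i := aeval_X _ _
    have hC : ∀ b, (aeval (fun i => C (v i) * linForm l + C a * projCoord l v i) :
        MvPolynomial σ A →ₐ[A] MvPolynomial σ A).toRingHom (C b) = C b := fun b => aeval_C _ _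
    rw [Polynomial.map_add, Polynomial.map_mul, Polynomial.map_C, Polynomial.map_C,
      Polynomial.map_X, hX, hC]
    simp only [projCoord]
    rw [map_add, map_mul, map_mul, map_sub, map_mul, hL, transl_X, transl_C, transl_C]
    simp only [C_add, C_mul, C_sub, Polynomial.C_add, Polynomial.C_mul, Polynomial.C_sub]
    ring

variable {K : Type*} [Field K] [CharZero K]

/-- If a family of forms of degree `t` vanishes at points which collide, as `ε → 0`, to the point
`w` along the five base points, then its limit vanishes at `w` to a large order. -/
theorem sum_le_three_mul_of_collision {F : MvPolynomial (Fin 4) (Polynomial K)} {t : ℕ}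
    (hF : F.IsHomogeneous t) {w : Fin 4 → K} (hw : ∑ i, 1 * w i = 1) (m : Fin 5 → ℕ)
    (hm : ∀ j, Polynomial.X ^ m j ∣ transl (fun i => Polynomial.C (w i) +
      Polynomial.X * (Polynomial.C (basePt K j i) - Polynomial.C (w i))) F) {d : ℕ}
    (hd : (homothety (fun _ => 1) w (map Polynomial.constantCoeff F)).coeff d ≠ 0) :
    ∑ j, m j ≤ 3 * d := by
  obtain ⟨φ, hφ⟩ : ∃ φ : Polynomial K →+* K, φ = Polynomial.constantCoeff := ⟨_, rfl⟩
  have hφC : ∀ a, φ (Polynomial.C a) = a := fun a => by simp [hφ]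
  let one : Fin 4 → Polynomial K := fun _ => 1
  let wA : Fin 4 → Polynomial K := fun i => Polynomial.C (w i)
  have hwA : ∑ i, one i * wA i = 1 := by
    have := congrArg Polynomial.C hw
    simpa [one, wA] using this
  have hnat : ∀ (u : Fin 4 → K) (G : MvPolynomial (Fin 4) (Polynomial K)) (k : ℕ),
      (homothety (fun _ => 1) u (map φ G)).coeff k =
        map φ ((homothety one (fun i => Polynomial.C (u i)) G).coeff k) := by
    intro u G k
    have := homothety_map φ one (fun i => Polynomial.C (u i)) G
    simp only [one, map_one, hφC] at this
    rw [this, Polynomial.coeff_map]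
  have hφX : map φ (C Polynomial.X : MvPolynomial (Fin 4) (Polynomial K)) = 0 := by simp [hφ]
  have hCX : (C Polynomial.X : MvPolynomial (Fin 4) (Polynomial K)) ≠ 0 := fun h =>
    Polynomial.X_ne_zero (C_eq_zero.mp h)
  rw [← hφ, hnat] at hd
  -- Magnification of the cluster: `h` vanishes at the fixed base points, and its k-th coefficient
  -- is that of `F` times the k-th power of ε.
  obtain ⟨h, hh⟩ : ∃ h, h = (homothety one wA F).eval (C Polynomial.X) := ⟨_, rfl⟩
  have hcoeff : ∀ k, (homothety one wA h).coeff k =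
      (homothety one wA F).coeff k * C Polynomial.X ^ k := fun k => by
    rw [hh, homothety_eval hwA, Polynomial.comp_C_mul_X_coeff]
  have hh0 : h ≠ 0 := by
    rintro rfl
    have := hcoeff d
    rw [map_zero, Polynomial.coeff_zero, eq_comm, mul_eq_zero] at this
    rcases this with h | h
    · exact hd (by rw [h, map_zero])
    · exact pow_ne_zero _ hCX h
  have hht : h.IsHomogeneous t := by
    rw [hh, eval_C_homothety]
    have := hF.aeval (fun i => C (wA i) * linForm one + C Polynomial.X * projCoord one wA i)
      (n := 1) fun i =>
        ((isHomogeneous_linForm _).C_mul _).add ((isHomogeneous_projCoord _ _ i).C_mul _)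
    simpa using this
  obtain ⟨e, g, hg, hg0⟩ := exists_eq_C_X_pow_mul hh0
  rw [← hφ] at hg0
  have hXe : (Polynomial.X ^ e : Polynomial K) ≠ 0 := pow_ne_zero _ Polynomial.X_ne_zero
  have hgt : g.IsHomogeneous t := isHomogeneous_of_C_mul hXe (hg ▸ hht)
  have hgcoeff : ∀ k, C Polynomial.X ^ e * (homothety one wA g).coeff k =
      (homothety one wA F).coeff k * C Polynomial.X ^ k := fun k => by
    rw [← hcoeff, hg, map_mul, homothety_C, Polynomial.coeff_C_mul, C_pow]
  -- The d-th coefficient of `F` survives at ε = 0, so at most ε^d can be divided out of `h`. The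
  -- coefficients of index above `d` then die in the limit `G`.
  have hed : e ≤ d := by
    by_contra! hlt
    apply hd
    have := hgcoeff d
    obtain ⟨i, rfl⟩ : ∃ i, e = d + (i + 1) := ⟨e - d - 1, by omega⟩
    rw [pow_add, mul_assoc, mul_comm _ (C Polynomial.X ^ d)] at this
    rw [← mul_left_cancel₀ (pow_ne_zero d hCX) this, map_mul, map_pow, hφX]
    simp
  obtain ⟨G, hG⟩ : ∃ G, G = map φ g := ⟨_, rfl⟩
  rw [← hG] at hg0
  have hGt : G.IsHomogeneous t := hG ▸ hgt.map φ
  have hGvanish : ∀ k, d < k → (homothety (fun _ => 1) w G).coeff k = 0 := by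
    intro k hk
    rw [hG, hnat]
    have := hgcoeff k
    obtain ⟨i, rfl⟩ : ∃ i, k = e + (i + 1) := ⟨k - e - 1, by omega⟩
    rw [pow_add, mul_left_comm] at this
    rw [mul_left_cancel₀ (pow_ne_zero e hCX) this, map_mul, map_pow, hφX]
    simp
  -- Only the coefficients of index at most `d` remain, and each contains at least t − d factors of
  -- the hyperplane. The hyperplane misses the base points, so the quotient keeps their
  -- multiplicities.
  have hdvd : linForm (fun _ => 1) ^ (t - d) ∣ G := by
    rw [← eval_one_homothety (fun _ => 1) w G, Polynomial.eval_eq_sum_range]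
    refine Finset.dvd_sum fun k _ => ?_
    rw [one_pow, mul_one]
    rcases lt_or_ge d k with hk | hk
    · rw [hGvanish k hk]; exact dvd_zero _
    · exact (pow_dvd_pow _ (by omega)).trans (linForm_pow_dvd_coeff_homothety hGt k)
  obtain ⟨H, hH⟩ := hdvd
  have hL0 : linForm (fun _ : Fin 4 => (1 : K)) ≠ 0 := linForm_ne_zero hw
  have hH0 : H ≠ 0 := by
    rintro rfl
    exact hg0 (by rw [mul_zero] at hH; exact hH)
  have hHdeg : H.totalDegree ≤ d := by
    have h1 := hGt.totalDegree hg0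
    rw [hH, totalDegree_mul_of_isDomain (pow_ne_zero _ hL0) hH0,
      ((isHomogeneous_linForm _).pow _).totalDegree (pow_ne_zero _ hL0)] at h1
    omega
  refine sum_le_three_mul_of_dvd_homothety hH0 hHdeg m fun j => ?_
  have h1 : Polynomial.X ^ m j ∣ transl (fun i => Polynomial.C (basePt K j i)) h := by
    have hq : ∑ i, one i * Polynomial.C (basePt K j i) = 1 := by
      have := congrArg Polynomial.C (sum_basePt (K := K) j)
      simpa [one] using this
    rw [hh, transl_eval_C_homothety hq]
    obtain ⟨Q, hQ⟩ := hm j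
    rw [hQ, Polynomial.map_mul, Polynomial.map_pow, Polynomial.map_X]
    exact dvd_mul_right _ _
  rw [hg, map_mul, transl_C] at h1
  have h2 := X_pow_dvd_of_dvd_C_mul (fun h => hXe (C_eq_zero.mp h)) h1
  have h3 : Polynomial.X ^ m j ∣ transl (basePt K j) G := by
    have h4 := transl_map φ (fun i => Polynomial.C (basePt K j i)) g
    simp only [hφC] at h4
    obtain ⟨Q, hQ⟩ := h2
    rw [← hG, hQ, Polynomial.map_mul, Polynomial.map_pow, Polynomial.map_X] at h4
    exact Dvd.intro _ h4.symm
  have h5 := X_pow_dvd_homothety_of_transl (sum_basePt j) hGt h3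
  rw [hH, map_mul, map_pow, homothety_linForm (sum_basePt j), ← Polynomial.C_pow] at h5
  exact X_pow_dvd_of_dvd_C_mul (pow_ne_zero _ hL0) h5

end Collision

/-! ### Degree bounds from special positions. -/

section Bounds

/-- If every system of vectors over an infinite field admits a form with prescribed vanishing, then
so does every system over a larger domain. -/
theorem hasForm_of_forall_hasForm {K A σ : Type*} [Field K] [Infinite K] [CommRing A] [IsDomain A]
    [Algebra K A] [Fintype σ] [DecidableEq σ] {n t : ℕ} {M : Fin n → ℕ}
    (h : ∀ v : Fin n → σ → K, HasForm v M t) (v : Fin n → σ → A) : HasForm v M t := by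
  refine (hasForm_iff K v M t).mpr fun r => ?_
  have : conditionMinor K r = 0 := MvPolynomial.funext fun x => by
    have := (hasForm_iff K (fun j i => x (j, i)) M t).mp (h _) r
    rw [map_zero]
    exact this
  rw [this, map_zero]

variable {K : Type*} [Field K] [CharZero K] {n t : ℕ}

/-- Restrict the form to the line through the base point and a point where it is nonzero. -/
theorem le_of_hasForm {v : Fin n → Fin 4 → K} {M : Fin n → ℕ} (h : HasForm v M t) {j : Fin n}
    {i : Fin 5} (hj : v j = basePt K i) : M j ≤ t := by
  obtain ⟨F, hF, hFt, hFv⟩ := h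
  have hdvd := X_pow_dvd_homothety_of_transl (sum_basePt i) hFt (hj ▸ hFv j)
  obtain ⟨b, hb⟩ : ∃ b, eval b F ≠ 0 := by
    by_contra! h
    exact hF (MvPolynomial.funext fun b => by rw [h b, map_zero])
  let c : Fin 4 → Polynomial K := fun k =>
    Polynomial.C (b k - basePt K i k) * Polynomial.X + Polynomial.C (basePt K i k)
  have hc := X_sub_C_pow_dvd_aeval (sum_basePt i) hdvd c 0 1 fun k => by simp [c]
  have heval : ∀ g : MvPolynomial (Fin 4) K, (aeval c g).eval 1 = eval b g := by
    intro g
    induction g using MvPolynomial.induction_on with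
    | C a => simp
    | add p q hp hq => rw [map_add, Polynomial.eval_add, hp, hq, map_add]
    | mul_X p k hp =>
      rw [map_mul, Polynomial.eval_mul, hp, map_mul, aeval_X, eval_X]
      simp [c]
  have hne : aeval c F ≠ 0 := fun h0 => hb (by rw [← heval, h0, Polynomial.eval_zero])
  have hdeg := aeval_natDegree_le F hFt.totalDegree_le c fun k => Polynomial.natDegree_linear_le
  have := Polynomial.natDegree_le_of_dvd hc hne
  rw [Polynomial.natDegree_pow, Polynomial.natDegree_X_sub_C] at this
  omega

theorem sum_le_three_mul_of_hasForm {v : Fin n → Fin 4 → K} {M : Fin n → ℕ} (h : HasForm v M t)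
    (m : Fin 5 → ℕ) (hm : ∀ i, m i = 0 ∨ ∃ j, v j = basePt K i ∧ m i = M j) :
    ∑ i, m i ≤ 3 * t := by
  obtain ⟨F, hF, hFt, hFv⟩ := h
  refine sum_le_three_mul_of_dvd_homothety hF hFt.totalDegree_le m fun i => ?_
  rcases hm i with h0 | ⟨j, hj, hmj⟩
  · rw [h0, pow_zero]; exact one_dvd _
  · rw [hmj]
    exact X_pow_dvd_homothety_of_transl (sum_basePt i) hFt (hj ▸ hFv j)

theorem mul_le_nine_mul_of_forall_hasForm {m : ℕ}
    (h : ∀ v : Fin 24 → Fin 4 → K, HasForm v (fun _ => m) t) : 24 * m ≤ 9 * t := by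
  let pt : Fin 5 → Fin 5 → Fin 4 → Polynomial K := fun i j k => Polynomial.C (basePt K i k) +
    Polynomial.X * (Polynomial.C (basePt K j k) - Polynomial.C (basePt K i k))
  -- The quotient by 5 selects the cluster and the remainder the point in it; of the 25 pairs only
  -- (4, 4) is left out.
  let v : Fin 24 → Fin 4 → Polynomial K := fun k =>
    pt ⟨k.1 / 5, by omega⟩ ⟨k.1 % 5, by omega⟩
  obtain ⟨F₀, hF₀, hF₀t, hF₀v⟩ := hasForm_of_forall_hasForm h v
  obtain ⟨e, F, hF, hF0⟩ := exists_eq_C_X_pow_mul hF₀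
  have hXe : (Polynomial.X ^ e : Polynomial K) ≠ 0 := pow_ne_zero _ Polynomial.X_ne_zero
  have hFt : F.IsHomogeneous t := isHomogeneous_of_C_mul hXe (hF ▸ hF₀t)
  have hFv : ∀ k, Polynomial.X ^ m ∣ transl (v k) F := fun k => by
    have := hF₀v k
    rw [hF, map_mul, transl_C] at this
    exact X_pow_dvd_of_dvd_C_mul (fun h => hXe (C_eq_zero.mp h)) this
  obtain ⟨f, hf⟩ : ∃ f, f = map Polynomial.constantCoeff F := ⟨_, rfl⟩
  have hft : f.IsHomogeneous t := hf ▸ hFt.map _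
  -- The trailing degree is the exact order of the limit form at the base point, so it serves both
  -- in the bound for `f` and as the degree bound for the magnified cluster.
  let d : Fin 5 → ℕ := fun i => (homothety (fun _ => 1) (basePt K i) f).natTrailingDegree
  have hd : ∑ i, d i ≤ 3 * t := by
    refine sum_le_three_mul_of_dvd_homothety (hf ▸ hF0) hft.totalDegree_le d fun i => ?_
    exact Polynomial.X_pow_dvd_iff.mpr fun k hk =>
      Polynomial.coeff_eq_zero_of_lt_natTrailingDegree hk
  let M : Fin 5 → Fin 5 → ℕ := fun i j => if 5 * i.1 + j.1 < 24 then m else 0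
  have hM : ∀ i, ∑ j, M i j ≤ 3 * d i := by
    intro i
    refine sum_le_three_mul_of_collision hFt (sum_basePt i) (M i) (fun j => ?_) ?_
    · by_cases hij : 5 * i.1 + j.1 < 24
      · have := hFv ⟨5 * i.1 + j.1, hij⟩
        have hi : (⟨(5 * i.1 + j.1) / 5, by omega⟩ : Fin 5) = i := Fin.ext (by simp; omega)
        have hj : (⟨(5 * i.1 + j.1) % 5, by omega⟩ : Fin 5) = j := Fin.ext (by simp)
        simp only [v, hi, hj] at this
        simpa only [M, if_pos hij] using this
      · simp only [M, if_neg hij, pow_zero]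
        exact one_dvd _
    · rw [← hf]
      have := homothety_ne_zero (l := fun _ => 1) (v := basePt K i) (hf ▸ hF0 : f ≠ 0)
      exact mt Polynomial.trailingCoeff_eq_zero.mp this
  have hsum : ∑ i, ∑ j, M i j = 24 * m := by
    simp [M, Fin.sum_univ_succ]
    ring
  have := Finset.sum_le_sum fun i (_ : i ∈ Finset.univ) => hM i
  rw [hsum, ← Finset.mul_sum] at this
  omega

end Bounds

end FatPoints

end

theorem mainTheorem7 (K : Type*) [Field K] [CharZero K] :
    (∃ g : ℝ, FatPoints.IsGenericWaldschmidtConstant K 3 ![1] g ∧ 1 ≤ g) ∧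
    (∃ g : ℝ, FatPoints.IsGenericWaldschmidtConstant K 3 (fun _ : Fin 4 => 1) g ∧ 4 / 3 ≤ g) ∧
    (∀ n : ℕ, n = 5 ∨ n = 6 ∨ n = 7 →
      ∃ g : ℝ, FatPoints.IsGenericWaldschmidtConstant K 3 (fun _ : Fin n => 1) g ∧ 5 / 3 ≤ g) ∧
    (∃ g : ℝ, FatPoints.IsGenericWaldschmidtConstant K 3 (fun _ : Fin 24 => 1) g ∧ 23 / 9 ≤ g) ∧
    (∃ g : ℝ, FatPoints.IsGenericWaldschmidtConstant K 3 ![2, 2, 2, 1, 1] g ∧ 8 / 3 ≤ g) ∧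
    (∃ g : ℝ, FatPoints.IsGenericWaldschmidtConstant K 3 ![2, 2, 1, 1, 1] g ∧ 7 / 3 ≤ g) := by
  refine ⟨?_, ?_, fun n hn => ?_, ?_, ?_, ?_⟩
  · refine FatPoints.exists_isGenericWaldschmidtConstant (by norm_num) (by simp) _ fun m t h => ?_
    have := FatPoints.le_of_hasForm (h fun _ => FatPoints.basePt K 0) (j := 0) rfl
    have : m ≤ t := by simpa using this
    rw [one_mul]
    exact_mod_cast this
  · refine FatPoints.exists_isGenericWaldschmidtConstant (by norm_num) (by simp) _ fun m t h => ?_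
    have := FatPoints.sum_le_three_mul_of_hasForm (h fun j => FatPoints.basePt K j.castSucc)
      (Fin.snoc (α := fun _ => ℕ) (fun _ => m) 0) fun i => by
        induction i using Fin.lastCases with
        | last => exact Or.inl (Fin.snoc_last _ _)
        | cast i => exact Or.inr ⟨i, rfl, by simp⟩
    rw [Fin.sum_univ_castSucc, Fin.snoc_last] at this
    have : 4 * m ≤ 3 * t := by simpa using this
    have : (4 * m : ℝ) ≤ 3 * t := by exact_mod_cast this
    linarith
  · have hn5 : 5 ≤ n := by omega
    refine FatPoints.exists_isGenericWaldschmidtConstant (by norm_num) (by simp) _ fun m t h => ?_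
    have := FatPoints.sum_le_three_mul_of_hasForm
      -- The vectors beyond the fifth play no role. The zero vector is allowed because `h` ranges
      -- over all systems of vectors.
      (h fun j => if hj : j.1 < 5 then FatPoints.basePt K ⟨j, hj⟩ else 0) (fun _ => m)
      fun i => Or.inr ⟨Fin.castLE hn5 i, by simp, by simp⟩
    have : 5 * m ≤ 3 * t := by simpa using this
    have : (5 * m : ℝ) ≤ 3 * t := by exact_mod_cast this
    linarith
  · refine FatPoints.exists_isGenericWaldschmidtConstant (by norm_num) (by simp) _ fun m t h => ?_
    have := FatPoints.mul_le_nine_mul_of_forall_hasForm (K := K) (m := m) (t := t)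
      (by simpa using h)
    -- This gives 24/9, slightly more than the required 23/9.
    have : (24 * m : ℝ) ≤ 9 * t := by exact_mod_cast this
    have : (0 : ℝ) ≤ m := by positivity
    linarith
  · refine FatPoints.exists_isGenericWaldschmidtConstant (by norm_num)
      (by intro j; fin_cases j <;> simp) _ fun m t h => ?_
    have := FatPoints.sum_le_three_mul_of_hasForm (h (FatPoints.basePt K)) _
      fun i => Or.inr ⟨i, rfl, rfl⟩
    have : m * 8 ≤ 3 * t := by
      simp [Fin.sum_univ_succ] at this
      omega
    have : (m * 8 : ℝ) ≤ 3 * t := by exact_mod_cast this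
    linarith
  · refine FatPoints.exists_isGenericWaldschmidtConstant (by norm_num)
      (by intro j; fin_cases j <;> simp) _ fun m t h => ?_
    have := FatPoints.sum_le_three_mul_of_hasForm (h (FatPoints.basePt K)) _
      fun i => Or.inr ⟨i, rfl, rfl⟩
    have : m * 7 ≤ 3 * t := by
      simp [Fin.sum_univ_succ] at this
      omega
    have : (m * 7 : ℝ) ≤ 3 * t := by exact_mod_cast this
    linarith
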